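/- Let $C$ be an elliptic curve over a field $k$, given by a Weierstrass equation, with point at infinity $\infty$ and function field $k(C)$. Let $\alpha>0$ be a rational number and let $D=\alpha(\infty)$. The section ring of $D$ is $$S_D=\bigoplus_{d\ge 0}H^0(dD)\,u^d\subseteq k(C)[u],\qquad H^0(dD)=\{f\in k(C): f=0\ \text{or}\ \operatorname{div} f+dD\ge 0\}.$$ A best lower approximation to $\alpha$ is a fraction $c/d\le\alpha$ in lowest terms ($d>0$) such that no fraction $c'/d'$ with $c/d<c'/d'\le\alpha$ has denominator $0<d'<d$. There are finitely many nonnegative ones, and we write them (in lowest terms) as $$0=\frac{c_0}{d_0}<\frac{c_1}{d_1}<\dots<\frac{c_r}{d_r}=\alpha ;$$ among them $c_1/d_1$ is the unique one with numerator $1$. For every integer $c\ge 0$ with $c\ne 1$ there is a nonzero function on $C$ whose polar divisor is $c(\infty)$; let $t_c$ be any such function, where for $c=0$ this means a nonzero constant. Then, for every such choice of the $t_c$, the functions $t_c u^d$ form a minimal generating set of the $k$-algebra $S_D$ (they generate $S_D$ and no proper subfamily does), where $(d,c)$ runs through the following pairs, which are pairwise distinct; here $\{x\}$ denotes the fractional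 part of $x$: (a) $(d,c)=(d_i,c_i)$ for $0\le i\le r$, $i\neq 1$; (b) $(d,c)=(\lceil 2/\alpha\rceil,2)$, if $\{-1/\alpha\}\in[0,1/2)$; (c) $(d,c)=(\lceil 3/\alpha\rceil,3)$, if $\{-1/\alpha\}\in[0,1/3)\cup[1/2,2/3)$; (d) $(d,c)=(d_1+d_2,\,c_1+c_2)$, if $\{-1/\alpha\}\in(0,1/2)$ (in which case $r\ge 2$). -/

import Mathlib

open scoped WithZero Polynomial

namespace EllipticSection

noncomputable section

/-! ### Places and `ℚ`-divisors of a function field -/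

/-- A place of a function field `K / k` of one variable, i.e. a closed point of the smooth
projective curve with function field `K`: a normalized (surjective) discrete valuation of `K`
that is trivial on `k`. Valuations are written multiplicatively, so that
`P.val f = exp (-ord_P f)` for `f ≠ 0`: a pole of order `n` means `P.val f = exp n`. -/
@[ext]
structure Place (k K : Type*) [Field k] [Field K] [Algebra k K] where
  val : Valuation K ℤᵐ⁰
  val_algebraMap : ∀ a : k, a ≠ 0 → val (algebraMap k K a) = 1
  surjective : Function.Surjective val

section Divisors

variable (k : Type*) {K : Type*} [Field k] [Field K] [Algebra k K]

/-- `H⁰(D)` for a `ℚ`-divisor `D`: the functions `f` with `div f + D ≥ 0`, that is,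
`-ord_P f ≤ ⌊D(P)⌋` for all `P`. -/
def sections (D : Place k K →₀ ℚ) : Submodule k K where
  carrier := {f | ∀ P : Place k K, P.val f ≤ WithZero.exp ⌊D P⌋}
  zero_mem' := fun P => by simp
  add_mem' := fun {f g} hf hg P => (P.val.map_add f g).trans (max_le (hf P) (hg P))
  smul_mem' := fun a f hf P => by
    rw [Algebra.smul_def, map_mul]
    by_cases ha : a = 0
    · simp [ha]
    · rw [P.val_algebraMap a ha, one_mul]
      exact hf P

/-- The section ring `S_D = ⨁_{d ≥ 0} H⁰(dD) u^d`, as a subalgebra of `K[u]`. -/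
def sectionRing (D : Place k K →₀ ℚ) : Subalgebra k K[X] where
  carrier := {F | ∀ d : ℕ, F.coeff d ∈ sections k ((d : ℚ) • D)}
  add_mem' := fun {F G} hF hG d => by
    rw [Polynomial.coeff_add]
    exact add_mem (hF d) (hG d)
  mul_mem' := fun {F G} hF hG d => by
    rw [Polynomial.coeff_mul]
    refine sum_mem fun ij hij => fun P => ?_
    rw [map_mul]
    refine (mul_le_mul' (hF ij.1 P) (hG ij.2 P)).trans ?_
    rw [← WithZero.exp_add, WithZero.exp_le_exp, ← Finset.HasAntidiagonal.mem_antidiagonal.1 hij]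
    simp only [Finsupp.smul_apply, smul_eq_mul, Nat.cast_add, add_mul]
    exact Int.le_floor_add _ _
  algebraMap_mem' := fun a d P => by
    rw [Polynomial.algebraMap_apply, Polynomial.coeff_C]
    split_ifs with h
    · by_cases ha : a = 0
      · simp [ha]
      · simp [h, P.val_algebraMap a ha]
    · simp

/-- `f` is a nonzero function whose polar divisor is exactly `c · (P)`: it has a pole of order
exactly `c` at `P` (for `c = 0`: neither a pole nor a zero), and no poles elsewhere. -/
def HasPolarDivisor (P : Place k K) (c : ℕ) (f : K) : Prop :=
  P.val f = WithZero.exp (c : ℤ) ∧ ∀ Q : Place k K, Q ≠ P → Q.val f ≤ 1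

end Divisors

/-- The family `f` is a minimal system of generators of the algebra `S`: it generates `S`, and
no proper subfamily does. -/
def IsMinimalGenerating {R A ι : Type*} [CommSemiring R] [Semiring A] [Algebra R A]
    (S : Subalgebra R A) (f : ι → A) : Prop :=
  Algebra.adjoin R (Set.range f) = S ∧
    ∀ J : Set ι, Algebra.adjoin R (f '' J) = S → J = Set.univ

/-! ### The point at infinity of a Weierstrass curve -/

section Infinity

open WeierstrassCurve.Affine WeierstrassCurve.Affine.CoordinateRing

variable {k : Type*} [Field k] (W : WeierstrassCurve.Affine k)

lemma norm_ne_zero {a : W.CoordinateRing} (ha : a ≠ 0) : Algebra.norm k[X] a ≠ 0 :=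
  (Algebra.norm_ne_zero_iff_of_basis (CoordinateRing.basis W)).2 ha

open Classical in
/-- The pole order at infinity on the affine coordinate ring: a function has as many poles at
infinity as it has affine zeros, and their number is the degree of its norm to `k[x]`. -/
def infinityValuationRing : Valuation W.CoordinateRing ℤᵐ⁰ where
  toFun a := if a = 0 then 0 else WithZero.exp ((Algebra.norm k[X] a).natDegree : ℤ)
  map_zero' := by simp
  map_one' := by simp
  map_mul' a b := by
    by_cases ha : a = 0
    · simp [ha]
    by_cases hb : b = 0
    · simp [hb]
    rw [if_neg ha, if_neg hb, if_neg (mul_ne_zero ha hb), map_mul,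
      Polynomial.natDegree_mul (norm_ne_zero W ha) (norm_ne_zero W hb), Nat.cast_add,
      WithZero.exp_add]
  map_add_le_max' a b := by
    by_cases hab : a + b = 0
    · simp [hab]
    by_cases ha : a = 0
    · simp [ha]
    by_cases hb : b = 0
    · simp [hb]
    rw [if_neg ha, if_neg hb, if_neg hab]
    have key : (Algebra.norm k[X] (a + b)).degree ≤
        max (Algebra.norm k[X] a).degree (Algebra.norm k[X] b).degree := by
      obtain ⟨p, q, rfl⟩ := exists_smul_basis_eq a
      obtain ⟨p', q', rfl⟩ := exists_smul_basis_eq b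
      have e : p • (1 : W.CoordinateRing) + q • mk W Polynomial.X +
          (p' • (1 : W.CoordinateRing) + q' • mk W Polynomial.X) =
          (p + p') • (1 : W.CoordinateRing) + (q + q') • mk W Polynomial.X := by
        rw [add_smul, add_smul]; abel
      rw [e, degree_norm_smul_basis, degree_norm_smul_basis, degree_norm_smul_basis]
      have hp := Polynomial.degree_add_le p p'
      have hq := Polynomial.degree_add_le q q'
      simp only [two_nsmul]
      refine max_le ?_ ?_
      · rcases le_max_iff.1 hp with h | h
        · exact (add_le_add h h).trans ((le_max_left _ _).trans (le_max_left _ _))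
        · exact (add_le_add h h).trans ((le_max_left _ _).trans (le_max_right _ _))
      · rcases le_max_iff.1 hq with h | h
        · exact (add_le_add_left (add_le_add h h) 3).trans
            ((le_max_right _ _).trans (le_max_left _ _))
        · exact (add_le_add_left (add_le_add h h) 3).trans
            ((le_max_right _ _).trans (le_max_right _ _))
    rw [le_max_iff, WithZero.exp_le_exp, WithZero.exp_le_exp, Nat.cast_le, Nat.cast_le]
    rcases le_max_iff.1 key with h | h
    · exact Or.inl (Polynomial.natDegree_le_natDegree h)
    · exact Or.inr (Polynomial.natDegree_le_natDegree h)

lemma infinityValuationRing_apply {a : W.CoordinateRing} (ha : a ≠ 0) :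
    infinityValuationRing W a = WithZero.exp ((Algebra.norm k[X] a).natDegree : ℤ) :=
  if_neg ha

lemma nonZeroDivisors_le :
    nonZeroDivisors W.CoordinateRing ≤ (infinityValuationRing W).supp.primeCompl := by
  intro a ha h
  rw [SetLike.mem_coe, Valuation.mem_supp_iff,
    infinityValuationRing_apply W (nonZeroDivisors.ne_zero ha)] at h
  exact WithZero.exp_ne_zero h

/-- The extension of the pole order at infinity to the function field. -/
def infinityValuation : Valuation W.FunctionField ℤᵐ⁰ :=
  (infinityValuationRing W).extendToLocalization (nonZeroDivisors_le W) W.FunctionField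

lemma infinityValuation_algebraMap (a : W.CoordinateRing) :
    infinityValuation W (algebraMap _ W.FunctionField a) = infinityValuationRing W a :=
  Valuation.extendToLocalization_apply_map_apply _ _ _ a

/-- The coordinate function `x`, in the coordinate ring. -/
abbrev coordX : W.CoordinateRing := mk W (Polynomial.C Polynomial.X)

/-- The coordinate function `y`, in the coordinate ring. -/
abbrev coordY : W.CoordinateRing := mk W Polynomial.X

lemma infinityValuationRing_smul_basis {p q : k[X]} {n : ℕ}
    (h : max (2 • p.degree) (2 • q.degree + 3) = n) :
    infinityValuationRing W (p • (1 : W.CoordinateRing) + q • mk W Polynomial.X) =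
      WithZero.exp (n : ℤ) := by
  have hd := (degree_norm_smul_basis (W' := W) p q).trans h
  have h0 : p • (1 : W.CoordinateRing) + q • mk W Polynomial.X ≠ 0 := by
    intro h0
    rw [h0, (Algebra.norm_eq_zero_iff_of_basis (CoordinateRing.basis W)).2 rfl] at hd
    simp at hd
  rw [infinityValuationRing_apply W h0, Polynomial.natDegree_eq_of_degree_eq_some hd]

/-- The function `x` has a pole of order `2` at infinity. -/
lemma infinityValuation_x :
    infinityValuation W (algebraMap _ _ (coordX W)) = WithZero.exp 2 := by
  rw [infinityValuation_algebraMap]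
  have := infinityValuationRing_smul_basis W (p := Polynomial.X) (q := 0) (n := 2)
    (by simp)
  simpa [CoordinateRing.smul] using this

/-- The function `y` has a pole of order `3` at infinity. -/
lemma infinityValuation_y :
    infinityValuation W (algebraMap _ _ (coordY W)) = WithZero.exp 3 := by
  rw [infinityValuation_algebraMap]
  have := infinityValuationRing_smul_basis W (p := 0) (q := 1) (n := 3) (by simp)
  simpa using this

/-- The point at infinity of a Weierstrass curve, as a place of its function field. -/
def infinity : Place k W.FunctionField where
  val := infinityValuation W
  val_algebraMap a ha := by
    rw [IsScalarTower.algebraMap_apply k W.CoordinateRing W.FunctionField,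
      infinityValuation_algebraMap]
    have := infinityValuationRing_smul_basis W (p := Polynomial.C a) (q := 0) (n := 0)
      (by simp [Polynomial.degree_C ha])
    rw [zero_smul, add_zero, CoordinateRing.smul, mul_one] at this
    exact this
  surjective z := by
    by_cases hz : z = 0
    · exact ⟨0, by simp [hz]⟩
    refine ⟨(algebraMap _ _ (coordY W) / algebraMap _ _ (coordX W)) ^ (WithZero.log z), ?_⟩
    rw [map_zpow₀, map_div₀, infinityValuation_x, infinityValuation_y, ← WithZero.exp_sub,
      ← WithZero.exp_zsmul]
    simp [WithZero.exp_log hz]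

end Infinity

/-! ### Best lower approximations and the list of generators -/

/-- `q` is a best lower approximation to `α`: `q ≤ α`, and no fraction that is closer to `α`
from below has a smaller denominator (`Rat.den` is the denominator in lowest terms). -/
def IsBestLowerApprox (α q : ℚ) : Prop :=
  q ≤ α ∧ ∀ s : ℚ, q < s → s ≤ α → q.den ≤ s.den

/-- `q 0 < q 1 < ⋯ < q r` are exactly the nonnegative best lower approximations to `α`. -/
def IsBestLowerSeq (α : ℚ) (r : ℕ) (q : ℕ → ℚ) : Prop :=
  StrictMonoOn q (Set.Iic r) ∧ q '' Set.Iic r = {s | 0 ≤ s ∧ IsBestLowerApprox α s}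

/-- Labels of the potential generators: one for each best lower approximation, and three
exceptional ones. -/
inductive GenIndex
  | best (i : ℕ)
  | ord2
  | ord3
  | sum12

/-- The condition, in terms of the fractional part of `-1/α`, for a label to be used. -/
def GenIndex.Occurs (α : ℚ) (r : ℕ) : GenIndex → Prop
  | best i => i ≤ r ∧ i ≠ 1
  | ord2 => Int.fract (-1 / α) ∈ Set.Ico (0 : ℚ) (1 / 2)
  | ord3 => Int.fract (-1 / α) ∈ Set.Ico (0 : ℚ) (1 / 3) ∪ Set.Ico (1 / 2 : ℚ) (2 / 3)
  | sum12 => Int.fract (-1 / α) ∈ Set.Ioo (0 : ℚ) (1 / 2)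

/-- The pair `(d, c)` attached to a label. -/
def GenIndex.pair (α : ℚ) (q : ℕ → ℚ) : GenIndex → ℕ × ℕ
  | best i => ((q i).den, (q i).num.toNat)
  | ord2 => (⌈2 / α⌉₊, 2)
  | ord3 => (⌈3 / α⌉₊, 3)
  | sum12 => ((q 1).den + (q 2).den, (q 1).num.toNat + (q 2).num.toNat)

end

end EllipticSection

/-!
The section ring of `α(∞)` is filtered by the pole order at infinity, and the theorem reduces to a
statement about the monoid of admissible pairs `(d, c)`, `c ≤ dα`, `c ≠ 1`.

*Geometry.* The coordinate ring is integrally closed: if `(p + q y) / π` is integral for a prime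
`π ∈ k[x]` not dividing both `p` and `q`, then `π` divides the trace and `π²` the norm of
`p + q y`, which gives a singular point with coordinates in `k[x]/(π)`
(`prime_dvd_of_isIntegral`). Hence the coordinate ring is a Dedekind domain, its primes give places,
and a function without affine poles lies in it (`mem_range_of_val_le_one`). Conversely infinity is
the only pole of `x` (`eq_infinity_of_one_lt`), so the elements of the coordinate ring have no
affine poles. Writing them as `p(x) + q(x) y` one reads off that every pole order except `1` occurs,
and that two functions with the same polar divisor agree up to a scalar and lower terms
(`exists_eq_zero_or_lt`). In particular functions `t_c`, `c ≠ 1`, form a basis.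

*Combinatorics.* With `b = ⌈1/α⌉`, `θ = {-1/α}` and `m = c b - d`, the condition `c ≤ dα` reads
`m ≤ c θ`. In these coordinates the exceptional pairs of the list become explicit: they are
`(2b, 2)`, `(3b, 3)` or `(3b - 1, 3)`, and `((n + 1) b - 1, n + 1)` with `n = ⌈1/θ⌉`, since the
second nonzero best lower approximation is `n / (n b - 1)` when `0 < θ < 1/2`. Every admissible pair
outside the list is a sum of two nonzero admissible pairs (`Params.isGenPair_or_splits`): if `c / d`
is not a best lower approximation, a better one `a / e` can be split off, unless `c - a = 1`, a case
treated by hand.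

*Generation* (`sectionRing_le`) follows by induction on the degree and the pole order.

*Minimality* (`mem_of_adjoin_eq`) needs more than irreducibility of the pairs in the monoid, because
leading terms of products can cancel. For a pair `(d, c)` of the list, products of functions of
smaller degrees with total degree `d` have pole order less than `c` (`Params.lt_of_isGenPair`), with
the single exception of `t_2² u²` against the pair `(2, 3)`. In either case the coefficients of
`u^d` of elements generated by the other members of the list lie in the span of functions with
pole orders different from `c`, and this span does not contain `t_c`.
-/

namespace EllipticSection

noncomputable section

/-! ### The coordinate ring of an elliptic curve is a Dedekind domain -/

section Dedekind

open WeierstrassCurve.Affine WeierstrassCurve.Affine.CoordinateRing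

variable {k : Type*} [Field k] (W : WeierstrassCurve.Affine k)

instance : Module.Finite k[X] W.CoordinateRing :=
  Module.Finite.of_basis (CoordinateRing.basis W)

/-- The trace to `k[x]` of `p + q y`. -/
def traceForm (p q : k[X]) : k[X] :=
  2 * p - q * (Polynomial.C W.a₁ * Polynomial.X + Polynomial.C W.a₃)

/-- The norm to `k[x]` of `p + q y`. -/
def normForm (p q : k[X]) : k[X] :=
  p ^ 2 - p * q * (Polynomial.C W.a₁ * Polynomial.X + Polynomial.C W.a₃) -
    q ^ 2 * (Polynomial.X ^ 3 + Polynomial.C W.a₂ * Polynomial.X ^ 2 +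
      Polynomial.C W.a₄ * Polynomial.X + Polynomial.C W.a₆)

lemma eval₂_negPolynomial :
    Polynomial.eval₂ (Algebra.ofId k[X] W.CoordinateRing).toRingHom (mk W W.negPolynomial)
      W.polynomial = 0 := by
  have h := smul_basis_mul_Y (W' := W) 0 1
  simp only [CoordinateRing.smul] at h
  simp only [WeierstrassCurve.Affine.polynomial, WeierstrassCurve.Affine.negPolynomial,
    Polynomial.eval₂_add, Polynomial.eval₂_sub, Polynomial.eval₂_mul, Polynomial.eval₂_pow,
    Polynomial.eval₂_X, Polynomial.eval₂_C]
  change _ + mk W (Polynomial.C _) * _ - mk W (Polynomial.C _) = 0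
  simp only [map_sub, map_neg, map_zero, map_one, map_add, map_mul, map_pow] at h ⊢
  linear_combination h

/-- The involution `(x, y) ↦ (x, -y - a₁x - a₃)` of the coordinate ring. -/
def conj : W.CoordinateRing →ₐ[k[X]] W.CoordinateRing :=
  AdjoinRoot.liftAlgHom W.polynomial (Algebra.ofId k[X] W.CoordinateRing)
    (mk W W.negPolynomial) (eval₂_negPolynomial W)

lemma conj_smul_basis (p q : k[X]) :
    conj W (p • (1 : W.CoordinateRing) + q • mk W Polynomial.X) =
      p • (1 : W.CoordinateRing) + q • mk W W.negPolynomial := by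
  rw [map_add, map_smul, map_smul, map_one]
  congr 2
  exact AdjoinRoot.lift_root (eval₂_negPolynomial W)

lemma add_conj (p q : k[X]) :
    (p • (1 : W.CoordinateRing) + q • mk W Polynomial.X) +
      conj W (p • (1 : W.CoordinateRing) + q • mk W Polynomial.X) =
      algebraMap k[X] W.CoordinateRing
        (traceForm W p q) := by
  rw [conj_smul_basis]
  simp only [CoordinateRing.smul, WeierstrassCurve.Affine.negPolynomial, traceForm]
  change _ = mk W (Polynomial.C _)
  simp only [map_sub, map_neg, map_add, map_mul, map_ofNat]
  ring

lemma mul_conj (p q : k[X]) :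
    (p • (1 : W.CoordinateRing) + q • mk W Polynomial.X) *
      conj W (p • (1 : W.CoordinateRing) + q • mk W Polynomial.X) =
      algebraMap k[X] W.CoordinateRing
        (normForm W p q) := by
  rw [conj_smul_basis]
  have h := smul_basis_mul_Y (W' := W) 0 1
  simp only [CoordinateRing.smul] at h
  simp only [CoordinateRing.smul, WeierstrassCurve.Affine.negPolynomial, normForm]
  change _ = mk W (Polynomial.C _)
  simp only [map_sub, map_neg, map_add, map_mul, map_pow, map_one, map_zero] at h ⊢
  linear_combination -(mk W (Polynomial.C q)) ^ 2 * h

lemma algebraMap_polynomial_injective :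
    Function.Injective (algebraMap k[X] W.FunctionField) := by
  rw [IsScalarTower.algebraMap_eq k[X] W.CoordinateRing W.FunctionField]
  exact (IsFractionRing.injective W.CoordinateRing W.FunctionField).comp
    (FaithfulSMul.algebraMap_injective k[X] W.CoordinateRing)

/-- An integral element of the function field of the form `a / b` with `a, b ∈ k[x]` is a
polynomial in `x`. -/
lemma dvd_of_isIntegral (a : k[X]) {b : k[X]} (hb : b ≠ 0) {f : W.FunctionField}
    (hf : IsIntegral k[X] f)
    (h : algebraMap k[X] W.FunctionField b * f = algebraMap k[X] W.FunctionField a) : b ∣ a := by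
  have hinj := algebraMap_polynomial_injective W
  let φ : FractionRing k[X] →ₐ[k[X]] W.FunctionField :=
    IsFractionRing.liftAlgHom (g := Algebra.ofId k[X] W.FunctionField) hinj
  have hb' : algebraMap k[X] W.FunctionField b ≠ 0 := by
    rwa [Ne, map_eq_zero_iff _ hinj]
  have hφ : φ (algebraMap _ _ a / algebraMap _ _ b) = f := by
    rw [map_div₀, AlgHom.commutes, AlgHom.commutes, div_eq_iff hb', ← h, mul_comm]
  rw [← hφ, isIntegral_algHom_iff φ φ.toRingHom.injective, IsIntegrallyClosed.isIntegral_iff] at hf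
  obtain ⟨c, hc⟩ := hf
  refine ⟨c, IsFractionRing.injective k[X] (FractionRing k[X]) ?_⟩
  rw [eq_div_iff (by simpa using hb)] at hc
  rw [map_mul, ← hc, mul_comm]

lemma conj_injective : Function.Injective (conj W) := by
  refine (injective_iff_map_eq_zero _).2 fun a ha => ?_
  obtain ⟨p, q, rfl⟩ := exists_smul_basis_eq a
  have h : p • (1 : W.CoordinateRing) + q • mk W W.negPolynomial =
      (p - q * (Polynomial.C W.a₁ * Polynomial.X + Polynomial.C W.a₃)) • (1 : W.CoordinateRing)
        + (-q) • mk W Polynomial.X := by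
    simp only [CoordinateRing.smul, WeierstrassCurve.Affine.negPolynomial]
    simp only [map_sub, map_neg, map_add, map_mul]
    ring
  rw [conj_smul_basis, h] at ha
  obtain ⟨e1, e2⟩ := smul_basis_eq_zero ha
  rw [neg_eq_zero] at e2
  subst e2
  rw [zero_mul, sub_zero] at e1
  subst e1
  simp

lemma algebraMap_comp_conj_injective : Function.Injective
    ((IsScalarTower.toAlgHom k[X] W.CoordinateRing W.FunctionField).comp (conj W)) := by
  rw [AlgHom.coe_comp]
  exact (IsFractionRing.injective W.CoordinateRing W.FunctionField).comp (conj_injective W)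

/-- The conjugation extended to the function field. -/
def conjField : W.FunctionField →ₐ[k[X]] W.FunctionField :=
  IsFractionRing.liftAlgHom (A := W.CoordinateRing)
    (g := (IsScalarTower.toAlgHom k[X] W.CoordinateRing W.FunctionField).comp (conj W))
    (algebraMap_comp_conj_injective W)

lemma conjField_algebraMap (a : W.CoordinateRing) :
    conjField W (algebraMap _ W.FunctionField a) = algebraMap _ W.FunctionField (conj W a) :=
  IsFractionRing.lift_algebraMap (algebraMap_comp_conj_injective W) a

/-- The local computation behind normality: if `(p + q y) / π` is integral for a prime `π ∈ k[x]`
not dividing both `p` and `q`, then `π` divides the trace and `π²` divides the norm of `p + q y`,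
so that the curve has a singular point over a root of `π`. -/
lemma prime_dvd_of_isIntegral [W.IsElliptic] {π p q : k[X]} (hπ : Prime π) {f : W.FunctionField}
    (hf : IsIntegral k[X] f)
    (h : algebraMap k[X] W.FunctionField π * f =
      algebraMap _ W.FunctionField (p • (1 : W.CoordinateRing) + q • mk W Polynomial.X)) :
    π ∣ p ∧ π ∣ q := by
  have hc : algebraMap k[X] W.FunctionField π * conjField W f =
      algebraMap _ W.FunctionField
        (conj W (p • (1 : W.CoordinateRing) + q • mk W Polynomial.X)) := by
    rw [← conjField_algebraMap, ← h, map_mul, AlgHom.commutes]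
  have hfc : IsIntegral k[X] (conjField W f) := hf.map _
  have htr := dvd_of_isIntegral W (traceForm W p q) hπ.ne_zero (hf.add hfc) (by
    rw [mul_add, h, hc, ← map_add, add_conj]
    exact (IsScalarTower.algebraMap_apply k[X] W.CoordinateRing W.FunctionField _).symm)
  have hnm' := dvd_of_isIntegral W (normForm W p q) (pow_ne_zero 2 hπ.ne_zero) (hf.mul hfc) (by
    rw [map_pow, sq (algebraMap k[X] W.FunctionField π), mul_mul_mul_comm, h, hc, ← map_mul, mul_conj]
    exact (IsScalarTower.algebraMap_apply k[X] W.CoordinateRing W.FunctionField _).symm)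
  have : Fact (Irreducible π) := ⟨hπ.irreducible⟩
  have hev (r : k[X]) : Polynomial.aeval (AdjoinRoot.root π) r = 0 ↔ π ∣ r := by
    rw [AdjoinRoot.aeval_eq, AdjoinRoot.mk_eq_zero]
  have hd : π ∣ Polynomial.derivative (normForm W p q) := by
    obtain ⟨s, hs⟩ := hnm'
    rw [hs, Polynomial.derivative_mul, Polynomial.derivative_pow]
    refine ⟨2 * Polynomial.derivative π * s + π * Polynomial.derivative s, ?_⟩
    rw [Nat.cast_ofNat, map_ofNat]
    ring
  replace hnm := (dvd_pow_self π two_ne_zero).trans hnm'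
  rw [← hev] at htr hnm hd
  rw [← hev, ← hev]
  simp only [traceForm, normForm, Polynomial.derivative_mul, Polynomial.derivative_pow,
    Polynomial.derivative_C, Polynomial.derivative_X, map_sub, map_add,
    map_mul, map_pow, Polynomial.aeval_X, Polynomial.aeval_C, map_ofNat, map_natCast, map_zero,
    map_one] at htr hnm hd
  generalize Polynomial.aeval (AdjoinRoot.root π) (Polynomial.derivative p) = P' at hd
  generalize Polynomial.aeval (AdjoinRoot.root π) (Polynomial.derivative q) = Q' at hd
  generalize Polynomial.aeval (AdjoinRoot.root π) p = P at *
  generalize Polynomial.aeval (AdjoinRoot.root π) q = Q at *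
  set x := AdjoinRoot.root π
  by_cases hQ : Q = 0
  · subst hQ
    refine ⟨?_, rfl⟩
    simpa using hnm
  exfalso
  obtain ⟨y, rfl⟩ : ∃ y, P = -(y * Q) := ⟨-P / Q, by field_simp⟩
  have hE : y ^ 2 + algebraMap k (AdjoinRoot π) W.a₁ * x * y +
      algebraMap k (AdjoinRoot π) W.a₃ * y = x ^ 3 + algebraMap k (AdjoinRoot π) W.a₂ * x ^ 2 +
        algebraMap k (AdjoinRoot π) W.a₄ * x + algebraMap k (AdjoinRoot π) W.a₆ := by
    apply mul_left_cancel₀ (pow_ne_zero 2 hQ)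
    linear_combination hnm
  have heq : (W.map (algebraMap k (AdjoinRoot π))).toAffine.Equation x y :=
    (WeierstrassCurve.Affine.equation_iff _ _).2 hE
  rcases ((WeierstrassCurve.Affine.nonsingular_iff' _ _).1
    (WeierstrassCurve.Affine.equation_iff_nonsingular.1 heq)).2 with h1 | h1
  · apply h1
    apply mul_left_cancel₀ (pow_ne_zero 2 hQ)
    push_cast at hd
    simp only [WeierstrassCurve.map_a₁, WeierstrassCurve.map_a₂, WeierstrassCurve.map_a₄]
    linear_combination hd - P' * htr - 2 * Q' * Q * hE - Q' * y * htr
  · apply h1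
    apply mul_left_cancel₀ hQ
    simp only [WeierstrassCurve.map_a₁, WeierstrassCurve.map_a₃]
    linear_combination -htr

/-- Denominators of integral elements can be cancelled one prime factor at a time. -/
lemma mem_range_of_isIntegral [W.IsElliptic] (d : k[X]) : d ≠ 0 → ∀ f : W.FunctionField,
    IsIntegral k[X] f → algebraMap k[X] W.FunctionField d * f ∈
      (algebraMap W.CoordinateRing W.FunctionField).range →
    f ∈ (algebraMap W.CoordinateRing W.FunctionField).range := by
  induction d using UniqueFactorizationMonoid.induction_on_prime with
  | h₁ => exact fun h => absurd rfl h
  | h₂ u hu =>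
    intro _ f _ h
    obtain ⟨v, hv⟩ := hu.exists_left_inv
    have := mul_mem (⟨algebraMap k[X] _ v, rfl⟩ :
      algebraMap W.CoordinateRing W.FunctionField (algebraMap k[X] _ v) ∈
        (algebraMap W.CoordinateRing W.FunctionField).range) h
    rwa [← IsScalarTower.algebraMap_apply, ← mul_assoc, ← map_mul, hv, map_one, one_mul] at this
  | h₃ a π ha hπ ih =>
    intro _ f hf h
    refine ih ha f hf ?_
    obtain ⟨z, hz⟩ := h
    obtain ⟨p, q, rfl⟩ := exists_smul_basis_eq z
    obtain ⟨⟨p, rfl⟩, ⟨q, rfl⟩⟩ := prime_dvd_of_isIntegral W hπ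
      (f := algebraMap k[X] W.FunctionField a * f) (isIntegral_algebraMap.mul hf)
      (by rw [hz, map_mul, mul_assoc])
    refine ⟨p • (1 : W.CoordinateRing) + q • mk W Polynomial.X, ?_⟩
    have hπ' : algebraMap k[X] W.FunctionField π ≠ 0 := by
      rw [Ne, map_eq_zero_iff _ (algebraMap_polynomial_injective W)]
      exact hπ.ne_zero
    apply mul_left_cancel₀ hπ'
    rw [← mul_assoc, ← map_mul, ← hz, mul_smul, mul_smul, ← smul_add, Algebra.smul_def π, map_mul,
      ← IsScalarTower.algebraMap_apply]

/-- Multiplying numerator and denominator of a function by the conjugate of the denominator gives a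
denominator in `k[x]`. -/
instance [W.IsElliptic] : IsIntegrallyClosed W.CoordinateRing := by
  rw [isIntegrallyClosed_iff W.FunctionField]
  intro f hf
  have hf' : IsIntegral k[X] f := isIntegral_trans f hf
  obtain ⟨a, b, hb, rfl⟩ := IsFractionRing.div_surjective (A := W.CoordinateRing) f
  have hb0 : b ≠ 0 := nonZeroDivisors.ne_zero hb
  obtain ⟨p, q, rfl⟩ := exists_smul_basis_eq b
  have hN := mul_conj W p q
  set b := p • (1 : W.CoordinateRing) + q • mk W Polynomial.X
  refine mem_range_of_isIntegral W (normForm W p q) (fun h0 => ?_) _ hf' ⟨a * conj W b, ?_⟩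
  rotate_left
  · rw [IsScalarTower.algebraMap_apply k[X] W.CoordinateRing, ← hN, map_mul, map_mul]
    have : algebraMap W.CoordinateRing W.FunctionField b ≠ 0 := by simpa using hb0
    field_simp
  · rw [h0, map_zero] at hN
    rcases mul_eq_zero.1 hN with h | h
    · exact hb0 h
    · exact hb0 (conj_injective W (h.trans (map_zero _).symm))

instance [W.IsElliptic] : IsDedekindDomain W.CoordinateRing where
  maximalOfPrime := (Ring.DimensionLEOne.of_isIntegral k[X] W.CoordinateRing).maximalOfPrime

end Dedekind

/-! ### Places of the function field -/

section Places

open WeierstrassCurve.Affine WeierstrassCurve.Affine.CoordinateRing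

variable {k : Type*} [Field k]

instance {K : Type*} [Field K] [Algebra k K] (P : Place k K) : P.val.IsTrivialOn k :=
  ⟨P.val_algebraMap⟩

lemma Place.val_algebraMap_le_one {K : Type*} [Field K] [Algebra k K] (P : Place k K) (a : k) :
    P.val (algebraMap k K a) ≤ 1 := by
  by_cases ha : a = 0
  · simp [ha]
  · exact (P.val_algebraMap a ha).le

lemma Place.val_smul {K : Type*} [Field K] [Algebra k K] (P : Place k K) {a : k} (ha : a ≠ 0)
    (f : K) : P.val (a • f) = P.val f := by
  rw [Algebra.smul_def, map_mul, P.val_algebraMap a ha, one_mul]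

variable (W : WeierstrassCurve.Affine k)

/-- The function `x` on the curve. -/
abbrev fnX : W.FunctionField := algebraMap _ _ (coordX W)

/-- The function `y` on the curve. -/
abbrev fnY : W.FunctionField := algebraMap _ _ (coordY W)

lemma algebraMap_eq_aeval (p : k[X]) :
    algebraMap k[X] W.FunctionField p = Polynomial.aeval (fnX W) p := by
  have h : IsScalarTower.toAlgHom k k[X] W.FunctionField = Polynomial.aeval (fnX W) := by
    ext
    simp only [IsScalarTower.coe_toAlgHom', Polynomial.aeval_X]
    rw [IsScalarTower.algebraMap_apply k[X] W.CoordinateRing W.FunctionField]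
    rfl
  exact DFunLike.congr_fun h p

lemma algebraMap_smul_basis (p q : k[X]) :
    algebraMap W.CoordinateRing W.FunctionField
      (p • (1 : W.CoordinateRing) + q • mk W Polynomial.X) =
      Polynomial.aeval (fnX W) p + Polynomial.aeval (fnX W) q * fnY W := by
  rw [map_add, Algebra.smul_def, Algebra.smul_def, map_mul, map_mul, map_one, mul_one,
    ← IsScalarTower.algebraMap_apply, ← IsScalarTower.algebraMap_apply, algebraMap_eq_aeval,
    algebraMap_eq_aeval]

/-- The Weierstrass equation, solved for `y²`. -/
lemma fnY_sq : fnY W ^ 2 =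
    fnX W ^ 3 + (algebraMap k _ W.a₂ * fnX W ^ 2 + algebraMap k _ W.a₄ * fnX W +
      algebraMap k _ W.a₆) - (algebraMap k _ W.a₁ * fnX W + algebraMap k _ W.a₃) * fnY W := by
  have h := congrArg (algebraMap W.CoordinateRing W.FunctionField)
    (smul_basis_mul_Y (W' := W) 0 1)
  rw [map_mul, algebraMap_smul_basis, algebraMap_smul_basis] at h
  simp only [map_zero, map_one, map_add, map_mul, map_pow, map_sub, Polynomial.aeval_X,
    Polynomial.aeval_C] at h
  linear_combination h

lemma infinity_val : (infinity W).val = infinityValuation W := rfl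

lemma val_aeval {P : Place k W.FunctionField} {m : ℕ} (hm : 0 < m)
    (hx : P.val (fnX W) = WithZero.exp ((2 * m : ℕ) : ℤ)) {p : k[X]} (hp : p ≠ 0) :
    P.val (Polynomial.aeval (fnX W) p) = WithZero.exp ((2 * p.natDegree * m : ℕ) : ℤ) := by
  have h1 : 1 < P.val (fnX W) := by
    rw [hx, ← WithZero.exp_zero, WithZero.exp_lt_exp]
    positivity
  rw [Polynomial.valuation_aeval_eq_valuation_X_pow_natDegree_of_one_lt_valuation_X _ h1 hp, hx,
    ← WithZero.exp_nsmul]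
  congr 1
  push_cast
  ring

lemma val_aeval_mul_fnY {P : Place k W.FunctionField} {m : ℕ} (hm : 0 < m)
    (hx : P.val (fnX W) = WithZero.exp ((2 * m : ℕ) : ℤ))
    (hy : P.val (fnY W) = WithZero.exp ((3 * m : ℕ) : ℤ)) {q : k[X]} (hq : q ≠ 0) :
    P.val (Polynomial.aeval (fnX W) q * fnY W) =
      WithZero.exp (((2 * q.natDegree + 3) * m : ℕ) : ℤ) := by
  rw [map_mul, val_aeval W hm hx hq, hy, ← WithZero.exp_add]
  congr 1
  push_cast
  ring

/-- If `x` has `2m` poles and `y` has `3m` poles at `P`, the pole orders of `p(x)` and `q(x) y`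
have different parities after division by `m`, so that there is no cancellation in
`p(x) + q(x) y`. Its pole order is `m` times a number `n ≠ 1` that depends on `p` and `q` only. -/
lemma exists_order {p q : k[X]} (h : p ≠ 0 ∨ q ≠ 0) :
    ∃ n : ℕ, n ≠ 1 ∧ ∀ (P : Place k W.FunctionField) (m : ℕ), 0 < m →
      P.val (fnX W) = WithZero.exp ((2 * m : ℕ) : ℤ) →
      P.val (fnY W) = WithZero.exp ((3 * m : ℕ) : ℤ) →
      P.val (Polynomial.aeval (fnX W) p + Polynomial.aeval (fnX W) q * fnY W) =
        WithZero.exp ((n * m : ℕ) : ℤ) := by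
  by_cases hp : p = 0
  · have hq := h.resolve_left (fun h => h hp)
    refine ⟨2 * q.natDegree + 3, by omega, fun P m hm hx hy => ?_⟩
    rw [hp, map_zero, zero_add, val_aeval_mul_fnY W hm hx hy hq]
  by_cases hq : q = 0
  · refine ⟨2 * p.natDegree, by omega, fun P m hm hx hy => ?_⟩
    rw [hq, map_zero, zero_mul, add_zero, val_aeval W hm hx hp]
  rcases lt_or_gt_of_ne (show 2 * p.natDegree ≠ 2 * q.natDegree + 3 by omega) with hlt | hlt
  · refine ⟨2 * q.natDegree + 3, by omega, fun P m hm hx hy => ?_⟩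
    rw [Valuation.map_add_eq_of_lt_right, val_aeval_mul_fnY W hm hx hy hq]
    rw [val_aeval W hm hx hp, val_aeval_mul_fnY W hm hx hy hq, WithZero.exp_lt_exp]
    exact_mod_cast Nat.mul_lt_mul_of_pos_right hlt hm
  · refine ⟨2 * p.natDegree, by omega, fun P m hm hx hy => ?_⟩
    rw [Valuation.map_add_eq_of_lt_left, val_aeval W hm hx hp]
    rw [val_aeval W hm hx hp, val_aeval_mul_fnY W hm hx hy hq, WithZero.exp_lt_exp]
    exact_mod_cast Nat.mul_lt_mul_of_pos_right hlt hm

lemma smul_basis_coeff_ne_zero {p q : k[X]}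
    (h : p • (1 : W.CoordinateRing) + q • mk W Polynomial.X ≠ 0) : p ≠ 0 ∨ q ≠ 0 := by
  by_contra! h'
  simp [h'.1, h'.2] at h

lemma infinity_val_algebraMap {a : W.CoordinateRing} (ha : a ≠ 0) :
    ∃ n : ℕ, n ≠ 1 ∧ (infinity W).val (algebraMap _ W.FunctionField a) = WithZero.exp (n : ℤ) := by
  obtain ⟨p, q, rfl⟩ := exists_smul_basis_eq a
  obtain ⟨n, hn, h⟩ := exists_order W (smul_basis_coeff_ne_zero W ha)
  refine ⟨n, hn, ?_⟩
  rw [algebraMap_smul_basis, h _ 1 one_pos (infinityValuation_x W) (infinityValuation_y W),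
    mul_one]

/-- Where `x` has a pole, the Weierstrass equation forces `x` and `y` to have pole orders `2m` and
`3m`. -/
lemma exists_val_fnX_eq (P : Place k W.FunctionField) (h : 1 < P.val (fnX W)) :
    ∃ m : ℕ, 0 < m ∧ P.val (fnX W) = WithZero.exp ((2 * m : ℕ) : ℤ) ∧
      P.val (fnY W) = WithZero.exp ((3 * m : ℕ) : ℤ) := by
  have hE := fnY_sq W
  set x := fnX W
  set y := fnY W
  have hx0 : (0 : ℤᵐ⁰) < P.val x := zero_lt_one.trans h
  have hlin : P.val (algebraMap k _ W.a₁ * x + algebraMap k _ W.a₃) ≤ P.val x := by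
    refine P.val.map_add_le ?_ ((P.val_algebraMap_le_one _).trans h.le)
    rw [map_mul]
    exact mul_le_of_le_one_left' (P.val_algebraMap_le_one _)
  have hquad : P.val (algebraMap k _ W.a₂ * x ^ 2 + algebraMap k _ W.a₄ * x + algebraMap k _ W.a₆)
      ≤ P.val x ^ 2 := by
    refine P.val.map_add_le (P.val.map_add_le ?_ ?_) ?_
    · rw [map_mul, map_pow]
      exact mul_le_of_le_one_left' (P.val_algebraMap_le_one _)
    · rw [map_mul]
      exact (mul_le_of_le_one_left' (P.val_algebraMap_le_one _)).trans
        (le_self_pow₀ h.le two_ne_zero)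
    · exact (P.val_algebraMap_le_one _).trans (one_le_pow₀ h.le)
  have h23 : P.val x ^ 2 < P.val x ^ 3 := pow_lt_pow_right₀ h (by norm_num)
  have hcub : P.val (x ^ 3 + (algebraMap k _ W.a₂ * x ^ 2 + algebraMap k _ W.a₄ * x +
      algebraMap k _ W.a₆)) = P.val x ^ 3 := by
    rw [Valuation.map_add_eq_of_lt_left, map_pow]
    rw [map_pow]
    exact hquad.trans_lt h23
  -- otherwise `x³` would be the only dominant term of the equation
  have hxy : P.val x < P.val y := by
    by_contra! hle
    have h1 : P.val (y ^ 2) = P.val x ^ 3 := by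
      rw [hE, Valuation.map_sub_eq_of_lt_left, hcub]
      rw [hcub, map_mul]
      exact ((mul_le_mul' hlin hle).trans (sq _).symm.le).trans_lt h23
    rw [map_pow] at h1
    exact absurd (pow_le_pow_left' hle 2) (not_le.2 (h1 ▸ h23))
  have h2 : P.val y ^ 2 = P.val x ^ 3 := by
    rw [← hcub, eq_add_of_sub_eq hE.symm, Valuation.map_add_eq_of_lt_left, map_pow]
    rw [map_mul, map_pow, sq]
    exact (mul_le_mul_left hlin _).trans_lt (mul_lt_mul_of_pos_right hxy (hx0.trans hxy))
  obtain ⟨a, ha⟩ : ∃ a : ℤ, P.val x = WithZero.exp a :=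
    ⟨_, (WithZero.exp_log hx0.ne').symm⟩
  obtain ⟨b, hb⟩ : ∃ b : ℤ, P.val y = WithZero.exp b :=
    ⟨_, (WithZero.exp_log (hx0.trans hxy).ne').symm⟩
  rw [ha, ← WithZero.exp_zero, WithZero.exp_lt_exp] at h
  rw [ha, hb, ← WithZero.exp_nsmul, ← WithZero.exp_nsmul, WithZero.exp_inj] at h2
  simp only [nsmul_eq_mul, Nat.cast_ofNat] at h2
  refine ⟨(b - a).toNat, by omega, ?_, ?_⟩
  · rw [ha]; congr 1; omega
  · rw [hb]; congr 1; omega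

/-- The point at infinity is the only pole of `x`. -/
lemma eq_infinity_of_one_lt (P : Place k W.FunctionField) (h : 1 < P.val (fnX W)) :
    P = infinity W := by
  obtain ⟨m, hm, hx, hy⟩ := exists_val_fnX_eq W P h
  have hR : ∀ a : W.CoordinateRing, P.val (algebraMap _ W.FunctionField a) =
      (infinity W).val (algebraMap _ W.FunctionField a) ^ m := by
    intro a
    by_cases ha : a = 0
    · simp [ha, hm.ne']
    obtain ⟨p, q, rfl⟩ := exists_smul_basis_eq a
    obtain ⟨n, -, h⟩ := exists_order W (smul_basis_coeff_ne_zero W ha)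
    rw [algebraMap_smul_basis, h P m hm hx hy,
      h _ 1 one_pos (infinityValuation_x W) (infinityValuation_y W), ← WithZero.exp_nsmul]
    congr 1
    push_cast
    simp [mul_comm]
  have hK : ∀ f : W.FunctionField, P.val f = (infinity W).val f ^ m := by
    intro f
    obtain ⟨a, b, hb, rfl⟩ := IsFractionRing.div_surjective (A := W.CoordinateRing) f
    rw [map_div₀, map_div₀, hR, hR, div_pow]
  -- a normalized valuation is a power of another one only if the exponent is one
  obtain ⟨f, hf⟩ := P.surjective (WithZero.exp 1)
  have hm1 : m = 1 := by
    have h1 := hK f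
    have hf0 : (infinity W).val f ≠ 0 := by
      intro h0
      rw [h0, zero_pow hm.ne', hf] at h1
      exact WithZero.exp_ne_zero h1
    rw [hf, ← WithZero.exp_log hf0, ← WithZero.exp_nsmul, WithZero.exp_inj] at h1
    simp only [nsmul_eq_mul] at h1
    have := Int.eq_one_or_neg_one_of_mul_eq_one h1.symm
    omega
  ext f
  rw [hK, hm1, pow_one]

lemma val_algebraMap_le_one {P : Place k W.FunctionField} (hP : P ≠ infinity W)
    (a : W.CoordinateRing) : P.val (algebraMap _ W.FunctionField a) ≤ 1 := by
  have hx : P.val (fnX W) ≤ 1 := not_lt.1 fun h => hP (eq_infinity_of_one_lt W P h)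
  have hpoly : ∀ p : k[X], P.val (Polynomial.aeval (fnX W) p) ≤ 1 := by
    intro p
    rw [Polynomial.aeval_eq_sum_range]
    refine P.val.map_sum_le fun i _ => ?_
    rw [Algebra.smul_def, map_mul, map_pow]
    exact mul_le_one' (P.val_algebraMap_le_one _) (pow_le_one' hx i)
  have hy : P.val (fnY W) ≤ 1 := by
    by_contra! h
    have h1 := fnY_sq W
    have h2 : P.val (fnY W ^ 2) ≤ P.val (fnY W) := by
      rw [h1]
      have e1 := hpoly (Polynomial.X ^ 3 + (Polynomial.C W.a₂ * Polynomial.X ^ 2 +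
        Polynomial.C W.a₄ * Polynomial.X + Polynomial.C W.a₆))
      have e2 := hpoly (Polynomial.C W.a₁ * Polynomial.X + Polynomial.C W.a₃)
      simp only [map_add, map_mul, map_pow, Polynomial.aeval_X, Polynomial.aeval_C] at e1 e2
      refine P.val.map_sub_le (e1.trans h.le) ?_
      rw [map_mul]
      exact mul_le_of_le_one_left' e2
    rw [map_pow] at h2
    exact absurd h2 (not_le.2 (lt_self_pow₀ h one_lt_two))
  obtain ⟨p, q, rfl⟩ := exists_smul_basis_eq a
  rw [algebraMap_smul_basis]
  refine P.val.map_add_le (hpoly p) ?_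
  rw [map_mul]
  exact mul_le_one' (hpoly q) hy

lemma val_aeval_sub_leadingCoeff_lt {p : k[X]} :
    (infinity W).val (Polynomial.aeval (fnX W) p - p.leadingCoeff • fnX W ^ p.natDegree) <
      WithZero.exp ((2 * p.natDegree : ℕ) : ℤ) := by
  have h : Polynomial.aeval (fnX W) p - p.leadingCoeff • fnX W ^ p.natDegree =
      Polynomial.aeval (fnX W) p.eraseLead := by
    have h := congrArg (Polynomial.aeval (fnX W)) p.eraseLead_add_C_mul_X_pow
    rw [map_add, map_mul, map_pow, Polynomial.aeval_C, Polynomial.aeval_X,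
      ← Algebra.smul_def] at h
    exact sub_eq_of_eq_add h.symm
  rw [h]
  by_cases h0 : p.eraseLead = 0
  · simp [h0]
  · rw [val_aeval W one_pos (infinityValuation_x W) h0, WithZero.exp_lt_exp, Nat.cast_lt]
    have := Polynomial.eraseLead_natDegree_lt_or_eraseLead_eq_zero p
    rcases this with h | h
    · omega
    · exact absurd h h0

variable [W.IsElliptic]

/-- The place attached to a closed point of the affine curve. -/
def affinePlace (p : IsDedekindDomain.HeightOneSpectrum W.CoordinateRing) :
    Place k W.FunctionField where
  val := p.valuation W.FunctionField
  val_algebraMap a ha := by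
    rw [IsScalarTower.algebraMap_apply k W.CoordinateRing W.FunctionField,
      p.valuation_eq_one_iff_notMem]
    intro h
    exact p.isPrime.ne_top (Ideal.eq_top_of_isUnit_mem _ h ((IsUnit.mk0 a ha).map _))
  surjective := p.valuation_surjective W.FunctionField

lemma affinePlace_ne_infinity (p : IsDedekindDomain.HeightOneSpectrum W.CoordinateRing) :
    affinePlace W p ≠ infinity W := by
  intro h
  have h1 : (affinePlace W p).val (fnX W) ≤ 1 := p.valuation_le_one (K := W.FunctionField) _
  rw [h, infinity_val, infinityValuation_x, ← WithZero.exp_zero, WithZero.exp_le_exp] at h1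
  norm_num at h1

/-- A function without affine poles belongs to the coordinate ring. -/
lemma mem_range_of_val_le_one {f : W.FunctionField}
    (h : ∀ P : Place k W.FunctionField, P ≠ infinity W → P.val f ≤ 1) :
    f ∈ (algebraMap W.CoordinateRing W.FunctionField).range :=
  IsDedekindDomain.HeightOneSpectrum.mem_integers_of_valuation_le_one _ _ fun p =>
    h (affinePlace W p) (affinePlace_ne_infinity W p)

end Places

/-! ### Functions with poles only at infinity -/

section PolarDivisor

open WeierstrassCurve.Affine WeierstrassCurve.Affine.CoordinateRing

variable {k : Type*} [Field k] {W : WeierstrassCurve.Affine k}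

lemma HasPolarDivisor.mul {c c' : ℕ} {f f' : W.FunctionField}
    (h : HasPolarDivisor k (infinity W) c f) (h' : HasPolarDivisor k (infinity W) c' f') :
    HasPolarDivisor k (infinity W) (c + c') (f * f') := by
  refine ⟨?_, fun Q hQ => ?_⟩
  · rw [map_mul, h.1, h'.1, ← WithZero.exp_add, Nat.cast_add]
  · rw [map_mul]
    exact mul_le_one' (h.2 Q hQ) (h'.2 Q hQ)

lemma HasPolarDivisor.ne_zero {c : ℕ} {f : W.FunctionField}
    (h : HasPolarDivisor k (infinity W) c f) : f ≠ 0 := by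
  rintro rfl
  exact WithZero.exp_ne_zero (h.1.symm.trans (map_zero _))

/-- Functions with different pole orders are linearly independent. -/
lemma linearIndependent_of_hasPolarDivisor {t : ℕ → W.FunctionField}
    (ht : ∀ c : ℕ, c ≠ 1 → HasPolarDivisor k (infinity W) c (t c)) :
    LinearIndependent k fun c : {c : ℕ // c ≠ 1} => t c := by
  have key : ∀ (s : Finset {c : ℕ // c ≠ 1}) (a : {c : ℕ // c ≠ 1} → k) (n : ℕ),
      (∀ c ∈ s, c.1 < n) → (infinity W).val (∑ c ∈ s, a c • t c) < WithZero.exp (n : ℤ) := by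
    intro s a n hs
    refine Valuation.map_sum_lt _ WithZero.exp_ne_zero fun c hc => ?_
    by_cases h0 : a c = 0
    · simp [h0]
    · rw [Place.val_smul _ h0, (ht c c.2).1, WithZero.exp_lt_exp, Nat.cast_lt]
      exact hs c hc
  rw [linearIndependent_iff']
  intro s
  induction s using Finset.induction_on_max with
  | empty => simp
  | insert m s hm ih =>
    intro a ha
    have hms : m ∉ s := fun h => (hm m h).false
    rw [Finset.sum_insert hms] at ha
    have ham : a m = 0 := by
      by_contra h0
      have h1 := key s a m.1 fun c hc => hm c hc
      rw [← (infinity W).val.map_neg, ← eq_neg_of_add_eq_zero_left ha, Place.val_smul _ h0,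
        (ht m m.2).1] at h1
      exact h1.false
    rw [ham, zero_smul, zero_add] at ha
    intro i hi
    rcases Finset.mem_insert.1 hi with rfl | hi
    · exact ham
    · exact ih a ha i hi

lemma notMem_span_of_hasPolarDivisor {t : ℕ → W.FunctionField}
    (ht : ∀ c : ℕ, c ≠ 1 → HasPolarDivisor k (infinity W) c (t c)) {c : ℕ} (hc : c ≠ 1) :
    t c ∉ Submodule.span k (t '' {e | e ≠ 1 ∧ e ≠ c}) := by
  have h := (linearIndependent_of_hasPolarDivisor ht).notMem_span_image
    (s := {e | e.1 ≠ c}) (x := ⟨c, hc⟩) (by simp)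
  convert! h using 3
  ext f
  constructor
  · rintro ⟨e, ⟨h1, h2⟩, rfl⟩
    exact ⟨⟨e, h1⟩, h2, rfl⟩
  · rintro ⟨⟨e, h1⟩, h2, rfl⟩
    exact ⟨e, ⟨h1, h2⟩, rfl⟩

variable (W) [W.IsElliptic]

/-- For an elliptic curve the condition on the finite places means membership in the coordinate
ring. -/
lemma hasPolarDivisor_iff {c : ℕ} {f : W.FunctionField} :
    HasPolarDivisor k (infinity W) c f ↔
      (infinity W).val f = WithZero.exp (c : ℤ) ∧
        f ∈ (algebraMap W.CoordinateRing W.FunctionField).range := by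
  refine and_congr_right fun _ => ⟨mem_range_of_val_le_one W, ?_⟩
  rintro ⟨a, rfl⟩ P hP
  exact val_algebraMap_le_one W hP a

lemma exists_hasPolarDivisor {f : W.FunctionField} (hf : f ≠ 0)
    (h : f ∈ (algebraMap W.CoordinateRing W.FunctionField).range) :
    ∃ c : ℕ, c ≠ 1 ∧ HasPolarDivisor k (infinity W) c f := by
  obtain ⟨a, rfl⟩ := h
  obtain ⟨n, hn, h⟩ := infinity_val_algebraMap W (a := a) (by rintro rfl; simp at hf)
  exact ⟨n, hn, (hasPolarDivisor_iff W).2 ⟨h, a, rfl⟩⟩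

variable {W}

/-- No function on an elliptic curve has a single simple pole. -/
lemma HasPolarDivisor.ne_one {c : ℕ} {f : W.FunctionField}
    (h : HasPolarDivisor k (infinity W) c f) : c ≠ 1 := by
  obtain ⟨c', hc', h'⟩ := exists_hasPolarDivisor W h.ne_zero ((hasPolarDivisor_iff W).1 h).2
  have := h.1.symm.trans h'.1
  rw [WithZero.exp_inj] at this
  omega

variable (W)

lemma hasPolarDivisor_one : HasPolarDivisor k (infinity W) 0 1 :=
  (hasPolarDivisor_iff W).2 ⟨by simp, one_mem _⟩

lemma hasPolarDivisor_fnX : HasPolarDivisor k (infinity W) 2 (fnX W) :=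
  (hasPolarDivisor_iff W).2 ⟨infinityValuation_x W, _, rfl⟩

lemma hasPolarDivisor_fnY : HasPolarDivisor k (infinity W) 3 (fnY W) :=
  (hasPolarDivisor_iff W).2 ⟨infinityValuation_y W, _, rfl⟩

lemma hasPolarDivisor_fnX_pow (i : ℕ) : HasPolarDivisor k (infinity W) (2 * i) (fnX W ^ i) := by
  induction i with
  | zero => simpa using hasPolarDivisor_one W
  | succ i ih => simpa [pow_succ, mul_add] using ih.mul (hasPolarDivisor_fnX W)

/-- The functions `xⁱ` and `xⁱ y` realize every pole order at infinity except `1`. -/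
lemma exists_hasPolarDivisor_of_ne_one {c : ℕ} (hc : c ≠ 1) :
    ∃ f : W.FunctionField, HasPolarDivisor k (infinity W) c f := by
  rcases Nat.even_or_odd' c with ⟨i, rfl | rfl⟩
  · exact ⟨_, hasPolarDivisor_fnX_pow W i⟩
  · obtain ⟨i, rfl⟩ : ∃ j, i = j + 1 := ⟨i - 1, by omega⟩
    exact ⟨_, by simpa [mul_add, add_assoc] using
      (hasPolarDivisor_fnX_pow W i).mul (hasPolarDivisor_fnY W)⟩

/-- Leading coefficients: a function in the coordinate ring agrees with a multiple of `xⁱ` or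
`xⁱ y` up to a function with a smaller pole order. -/
lemma exists_smul_sub_lt_fn {c : ℕ} {f : W.FunctionField}
    (h : HasPolarDivisor k (infinity W) c f) :
    ∃ a : k, (infinity W).val (f - a • (if Even c then fnX W ^ (c / 2) else
      fnX W ^ ((c - 3) / 2) * fnY W)) < WithZero.exp (c : ℤ) := by
  obtain ⟨hv, g, rfl⟩ := (hasPolarDivisor_iff W).1 h
  obtain ⟨p, q, rfl⟩ := exists_smul_basis_eq g
  rw [algebraMap_smul_basis] at hv ⊢
  have hX := infinityValuation_x W
  have hY := infinityValuation_y W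
  have hp (hp : p ≠ 0) := val_aeval (P := infinity W) W one_pos hX hp
  have hq (hq : q ≠ 0) := val_aeval_mul_fnY (P := infinity W) W one_pos hX hY hq
  simp only [mul_one] at hp hq
  set A := Polynomial.aeval (fnX W) p
  set B := Polynomial.aeval (fnX W) q * fnY W
  have hcases : (c = 2 * p.natDegree ∧ (infinity W).val B < WithZero.exp (c : ℤ)) ∨
      (c = 2 * q.natDegree + 3 ∧ (infinity W).val A < WithZero.exp (c : ℤ)) := by
    by_cases hp0 : p = 0
    · have hA : A = 0 := by simp [A, hp0]
      by_cases hq0 : q = 0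
      · simp only [hA, B, hq0, map_zero, zero_mul, add_zero] at hv
        exact absurd hv.symm WithZero.exp_ne_zero
      · rw [hA, zero_add, hq hq0, WithZero.exp_inj, Nat.cast_inj] at hv
        exact Or.inr ⟨hv.symm, by simp [hA]⟩
    by_cases hq0 : q = 0
    · have hB : B = 0 := by simp [B, hq0]
      rw [hB, add_zero, hp hp0, WithZero.exp_inj, Nat.cast_inj] at hv
      exact Or.inl ⟨hv.symm, by simp [hB]⟩
    replace hp := hp hp0
    replace hq := hq hq0
    rcases lt_or_gt_of_ne (show 2 * p.natDegree ≠ 2 * q.natDegree + 3 by omega) with hlt | hlt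
    · have hAB : (infinity W).val A < (infinity W).val B := by
        rw [hp, hq, WithZero.exp_lt_exp, Nat.cast_lt]
        exact hlt
      rw [Valuation.map_add_eq_of_lt_right _ hAB] at hv
      refine Or.inr ⟨?_, hv ▸ hAB⟩
      rw [hq, WithZero.exp_inj, Nat.cast_inj] at hv
      exact hv.symm
    · have hAB : (infinity W).val B < (infinity W).val A := by
        rw [hp, hq, WithZero.exp_lt_exp, Nat.cast_lt]
        exact hlt
      rw [Valuation.map_add_eq_of_lt_left _ hAB] at hv
      refine Or.inl ⟨?_, hv ▸ hAB⟩
      rw [hp, WithZero.exp_inj, Nat.cast_inj] at hv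
      exact hv.symm
  rcases hcases with ⟨rfl, hB⟩ | ⟨rfl, hA⟩
  · refine ⟨p.leadingCoeff, ?_⟩
    rw [if_pos (by simp), Nat.mul_div_cancel_left _ two_pos, add_sub_right_comm]
    exact Valuation.map_add_lt _ (val_aeval_sub_leadingCoeff_lt W) hB
  · refine ⟨q.leadingCoeff, ?_⟩
    rw [if_neg (by simp [parity_simps]), Nat.add_sub_cancel, Nat.mul_div_cancel_left _ two_pos,
      add_sub_assoc]
    refine Valuation.map_add_lt _ hA ?_
    rw [← smul_mul_assoc, ← sub_mul, map_mul, infinity_val, hY, ← infinity_val, Nat.cast_add,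
      WithZero.exp_add]
    exact mul_lt_mul_of_pos_right (val_aeval_sub_leadingCoeff_lt W) (by simp)

/-- The residue field at infinity is `k`: two functions with the same pole order at infinity agree
up to a scalar and a function with a smaller pole order. -/
lemma exists_smul_sub_lt {c : ℕ} {f g : W.FunctionField}
    (hf : HasPolarDivisor k (infinity W) c f) (hg : HasPolarDivisor k (infinity W) c g) :
    ∃ a : k, (infinity W).val (f - a • g) < WithZero.exp (c : ℤ) := by
  obtain ⟨a, ha⟩ := exists_smul_sub_lt_fn W hf
  obtain ⟨b, hb⟩ := exists_smul_sub_lt_fn W hg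
  set e := if Even c then fnX W ^ (c / 2) else fnX W ^ ((c - 3) / 2) * fnY W
  have hb0 : b ≠ 0 := by
    rintro rfl
    rw [zero_smul, sub_zero, hg.1] at hb
    exact hb.false
  refine ⟨a / b, ?_⟩
  have : f - (a / b) • g = (f - a • e) - (a / b) • (g - b • e) := by
    rw [smul_sub, smul_smul, div_mul_cancel₀ _ hb0]
    abel
  rw [this]
  refine Valuation.map_sub_lt _ ha ?_
  by_cases ha0 : a = 0
  · simp [ha0]
  · rwa [Place.val_smul _ (div_ne_zero ha0 hb0)]

/-- Subtracting a multiple of `g` from a function `f` with the same polar divisor lowers the pole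
order. -/
lemma exists_eq_zero_or_lt {c : ℕ} {f g : W.FunctionField}
    (hf : HasPolarDivisor k (infinity W) c f) (hg : HasPolarDivisor k (infinity W) c g) :
    ∃ a : k, f - a • g = 0 ∨ ∃ e < c, HasPolarDivisor k (infinity W) e (f - a • g) := by
  obtain ⟨a, ha⟩ := exists_smul_sub_lt W hf hg
  refine ⟨a, or_iff_not_imp_left.2 fun h0 => ?_⟩
  have hmem : f - a • g ∈ (algebraMap W.CoordinateRing W.FunctionField).range := by
    refine sub_mem ((hasPolarDivisor_iff W).1 hf).2 ?_
    rw [Algebra.smul_def, IsScalarTower.algebraMap_apply k W.CoordinateRing W.FunctionField]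
    exact mul_mem ⟨_, rfl⟩ ((hasPolarDivisor_iff W).1 hg).2
  obtain ⟨e, -, he⟩ := exists_hasPolarDivisor W h0 hmem
  rw [he.1, WithZero.exp_lt_exp, Nat.cast_lt] at ha
  exact ⟨e, ha, he⟩

/-- A function without zeros and poles is constant. -/
lemma exists_eq_smul_one {f : W.FunctionField} (hf : HasPolarDivisor k (infinity W) 0 f) :
    ∃ a : k, f = a • (1 : W.FunctionField) := by
  obtain ⟨a, h | ⟨e, he, -⟩⟩ := exists_eq_zero_or_lt W hf (hasPolarDivisor_one W)
  · exact ⟨a, sub_eq_zero.1 h⟩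
  · omega

/-- Functions `t c` with polar divisor `c(∞)` for `c ≠ 1` span the coordinate ring, compatibly with
the filtration by the pole order. -/
lemma mem_span_of_hasPolarDivisor {t : ℕ → W.FunctionField}
    (ht : ∀ c : ℕ, c ≠ 1 → HasPolarDivisor k (infinity W) c (t c)) {c : ℕ} {f : W.FunctionField}
    (hf : HasPolarDivisor k (infinity W) c f) :
    f ∈ Submodule.span k (t '' {e | e ≠ 1 ∧ e ≤ c}) := by
  induction c using Nat.strong_induction_on generalizing f with
  | _ c ih =>
    obtain ⟨a, ha⟩ := exists_eq_zero_or_lt W hf (ht c hf.ne_one)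
    have htc : a • t c ∈ Submodule.span k (t '' {e | e ≠ 1 ∧ e ≤ c}) :=
      Submodule.smul_mem _ _ (Submodule.subset_span ⟨c, ⟨hf.ne_one, le_rfl⟩, rfl⟩)
    rcases ha with h0 | ⟨e, hec, he⟩
    · rwa [sub_eq_zero.1 h0]
    rw [← sub_add_cancel f (a • t c)]
    have hsub : {i | i ≠ 1 ∧ i ≤ e} ⊆ {i | i ≠ 1 ∧ i ≤ c} := fun i hi => ⟨hi.1, hi.2.trans hec.le⟩
    exact add_mem (Submodule.span_mono (Set.image_mono hsub) (ih e hec he)) htc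

/-- `H⁰(dα(∞))` consists of the functions with polar divisor `c(∞)`, `c ≤ dα`. -/
lemma mem_sections_iff {α : ℚ} {d : ℕ} {f : W.FunctionField} :
    f ∈ sections k ((d : ℚ) • Finsupp.single (infinity W) α) ↔
      f = 0 ∨ ∃ c : ℕ, HasPolarDivisor k (infinity W) c f ∧ (c : ℚ) ≤ d * α := by
  constructor
  · intro h
    by_cases h0 : f = 0
    · exact Or.inl h0
    obtain ⟨c, -, hc⟩ := exists_hasPolarDivisor W h0 (mem_range_of_val_le_one W fun P hP => by
      simpa [Finsupp.single_apply, hP.symm] using h P)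
    refine Or.inr ⟨c, hc, ?_⟩
    have := h (infinity W)
    rw [hc.1, WithZero.exp_le_exp, Int.le_floor] at this
    simpa using this
  · rintro (rfl | ⟨c, hc, hle⟩)
    · exact zero_mem _
    intro P
    by_cases hP : P = infinity W
    · rw [hP, hc.1, WithZero.exp_le_exp, Int.le_floor]
      simpa using hle
    · simpa [Finsupp.single_apply, Ne.symm hP] using hc.2 P hP

end PolarDivisor

/-! ### Best lower approximations as pairs of natural numbers -/

section BestPair

/-- The fraction `c / d` is in lowest terms and is a best lower approximation to `α`; a fraction
`a / e ≤ α` with `e < d` satisfies `a / e ≤ c / d`. -/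
structure BestPair (α : ℚ) (d c : ℕ) : Prop where
  pos : 0 < d
  coprime : Nat.Coprime c d
  le : (c : ℚ) ≤ d * α
  max : ∀ a e : ℕ, 0 < e → e < d → (a : ℚ) ≤ e * α → a * d ≤ c * e

variable {α : ℚ}

lemma num_toNat_div_den {q : ℚ} (hq : 0 ≤ q) : (q.num.toNat : ℚ) / q.den = q := by
  have h : ((q.num.toNat : ℤ) : ℚ) = q.num := by
    rw [Int.toNat_of_nonneg (Rat.num_nonneg.2 hq)]
  rw [← Int.cast_natCast, h, Rat.num_div_den]

lemma isBestLowerApprox_iff {q : ℚ} (hq : 0 ≤ q) :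
    IsBestLowerApprox α q ↔ BestPair α q.den q.num.toNat := by
  have hd : (0 : ℚ) < q.den := by exact_mod_cast q.den_pos
  constructor
  · rintro ⟨hle, h⟩
    refine ⟨q.den_pos, ?_, ?_, fun a e he hed hae => ?_⟩
    · have := q.reduced
      rwa [← Int.toNat_of_nonneg (Rat.num_nonneg.2 hq), Int.natAbs_natCast] at this
    · rw [← num_toNat_div_den hq, div_le_iff₀ hd, mul_comm] at hle
      exact hle
    · have he' : (0 : ℚ) < e := by exact_mod_cast he
      by_contra! hlt
      have h1 : q < (a : ℚ) / e := by
        rw [← num_toNat_div_den hq, div_lt_div_iff₀ hd he']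
        exact_mod_cast hlt
      have h2 := h _ h1 ((div_le_iff₀ he').2 (by rwa [mul_comm]))
      have h3 : ((a : ℚ) / e).den ≤ e := by
        have := Rat.den_dvd (a : ℤ) (e : ℤ)
        simp only [Rat.divInt_eq_div, Int.cast_natCast] at this
        exact Nat.le_of_dvd he (Int.natCast_dvd_natCast.1 this)
      omega
  · rintro ⟨-, -, hle, h⟩
    refine ⟨?_, fun s hqs hs => ?_⟩
    · rw [← num_toNat_div_den hq, div_le_iff₀ hd, mul_comm]
      exact hle
    · by_contra! hlt
      have hs0 := hq.trans hqs.le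
      have hsd : (0 : ℚ) < s.den := by exact_mod_cast s.den_pos
      rw [← num_toNat_div_den hs0, div_le_iff₀ hsd, mul_comm] at hs
      have := h _ _ s.den_pos hlt hs
      rw [← num_toNat_div_den hq, ← num_toNat_div_den hs0, div_lt_div_iff₀ hd hsd] at hqs
      have hqs' : q.num.toNat * s.den < s.num.toNat * q.den := by exact_mod_cast hqs
      omega

lemma num_den_of_coprime {c d : ℕ} (hd : 0 < d) (h : Nat.Coprime c d) :
    ((c : ℚ) / d).den = d ∧ ((c : ℚ) / d).num.toNat = c := by
  have h1 := Rat.den_div_eq_of_coprime (a := c) (b := d) (by exact_mod_cast hd) (by simpa using h)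
  have h2 := Rat.num_div_eq_of_coprime (a := c) (b := d) (by exact_mod_cast hd) (by simpa using h)
  push_cast at h1 h2
  exact ⟨by exact_mod_cast h1, by rw [h2]; simp⟩

lemma BestPair.isBestLowerApprox {d c : ℕ} (h : BestPair α d c) :
    IsBestLowerApprox α ((c : ℚ) / d) := by
  rw [isBestLowerApprox_iff (by positivity), (num_den_of_coprime h.pos h.coprime).1,
    (num_den_of_coprime h.pos h.coprime).2]
  exact h

end BestPair

/-! ### Arithmetic in terms of the fractional part of `-1/α` -/

/-- The data `b = ⌈1/α⌉` and `θ = {-1/α} = b - 1/α` on which the list of generators depends,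
together with `n = ⌈1/θ⌉`, which is relevant for `0 < θ < 1/2`. -/
structure Params (α θ : ℚ) (b n : ℕ) : Prop where
  pos : 0 < α
  mul_sub : α * (b - θ) = 1
  nonneg : 0 ≤ θ
  lt_one : θ < 1
  one_le : 0 < θ → 1 ≤ n * θ
  lt_of_pos : (n - 1) * θ < 1

namespace Params

variable {α θ : ℚ} {b n : ℕ} (P : Params α θ b n)
include P

lemma b_pos : 1 ≤ b := by
  have h1 := P.mul_sub
  have h2 := P.pos
  have h3 := P.nonneg
  by_contra! h
  interval_cases b
  push_cast at h1
  nlinarith [mul_nonneg h2.le h3]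

lemma b_sub_pos : 0 < (b : ℚ) - θ := by
  have : (1 : ℚ) ≤ b := by exact_mod_cast P.b_pos
  linarith [P.lt_one]

/-- In the coordinates `(c, m) = (c, c b - d)` the condition `c ≤ d α` becomes `m ≤ c θ`. -/
lemma le_iff {c d : ℕ} : (c : ℚ) ≤ d * α ↔ (c : ℚ) * b - d ≤ c * θ := by
  have h := P.b_sub_pos
  rw [← mul_le_mul_iff_left₀ h, mul_assoc, P.mul_sub, mul_one]
  constructor <;> intro h <;> linarith

lemma three_le (h0 : 0 < θ) (h : θ < 1 / 2) : 3 ≤ n := by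
  have := P.one_le h0
  by_contra! hn
  have : (n : ℚ) ≤ 2 := by exact_mod_cast Nat.le_of_lt_succ hn
  nlinarith

lemma best_zero : BestPair α 1 0 :=
  ⟨one_pos, by simp, by simpa using P.pos.le, fun a e he he1 => by omega⟩

lemma best_one : BestPair α b 1 := by
  refine ⟨P.b_pos, by simp, P.le_iff.2 (by simpa using P.nonneg), fun a e he heb hae => ?_⟩
  rw [P.le_iff] at hae
  have h1 : (e : ℚ) + 1 ≤ b := by exact_mod_cast heb
  rcases Nat.eq_zero_or_pos a with rfl | ha
  · simp
  · have ha' : (1 : ℚ) ≤ a := by exact_mod_cast ha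
    nlinarith [mul_le_mul_of_nonneg_right ha' P.b_sub_pos.le, P.lt_one]

/-- A fraction `a / e ≤ α` satisfies `e ≥ a / α`, where `1 / α = b - θ`. -/
lemma mul_sub_le {a e : ℕ} (h : (a : ℚ) ≤ e * α) : (a : ℚ) * (b - θ) ≤ e := by
  rw [P.le_iff] at h
  linarith

/-- Since `θ < 1`, a fraction `a / e ≤ α` with `a ≥ k` has `e > k (b - 1)`. -/
lemma mul_lt_add {a e k : ℕ} (ha : k ≤ a) (h : (a : ℚ) ≤ e * α) (hk : 0 < k) :
    k * b < e + k := by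
  have h1 := P.mul_sub_le h
  have h2 := P.b_sub_pos
  have ha' : (k : ℚ) ≤ a := by exact_mod_cast ha
  have hk' : (0 : ℚ) < k := by exact_mod_cast hk
  have : ((k * b : ℕ) : ℚ) < ((e + k : ℕ) : ℚ) := by
    push_cast
    nlinarith [mul_le_mul_of_nonneg_right ha' h2.le, mul_lt_mul_of_pos_left P.lt_one hk']
  exact_mod_cast this

lemma best_two (h : 1 / 2 ≤ θ) : BestPair α (2 * b - 1) 2 := by
  have hb := P.b_pos
  obtain ⟨b', rfl⟩ : ∃ b', b = b' + 1 := ⟨b - 1, by omega⟩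
  have hd : 2 * (b' + 1) - 1 = 2 * b' + 1 := by omega
  rw [hd]
  refine ⟨by omega, by simp, P.le_iff.2 ?_, fun a e he hed hae => ?_⟩
  · push_cast
    linarith
  · rcases Nat.lt_or_ge a 2 with ha | ha
    · interval_cases a
      · simp
      · have := P.mul_lt_add le_rfl hae one_pos
        omega
    · have := P.mul_lt_add ha hae two_pos
      omega

lemma best_three (h : 2 / 3 ≤ θ) : BestPair α (3 * b - 2) 3 := by
  have hb := P.b_pos
  obtain ⟨b', rfl⟩ : ∃ b', b = b' + 1 := ⟨b - 1, by omega⟩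
  have hd : 3 * (b' + 1) - 2 = 3 * b' + 1 := by omega
  rw [hd]
  refine ⟨by omega, by simp, P.le_iff.2 ?_, fun a e he hed hae => ?_⟩
  · push_cast
    linarith
  · rcases Nat.lt_or_ge a 3 with ha | ha
    · interval_cases a
      · simp
      · have := P.mul_lt_add le_rfl hae one_pos
        omega
      · have := P.mul_lt_add le_rfl hae two_pos
        omega
    · have := P.mul_lt_add ha hae three_pos
      omega

/-- For `a / e ≤ α` with `m = a b - e ≥ 1` the numerator is larger than `m (n - 1)`. -/
lemma mul_pred_lt (h0 : 0 < θ) {a e : ℕ} (h : (a : ℚ) ≤ e * α) (hm : (1 : ℤ) ≤ a * b - e) :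
    ((a : ℤ) * b - e) * (n - 1) < a := by
  rw [P.le_iff] at h
  have h1 : (1 : ℚ) ≤ a * b - e := by exact_mod_cast hm
  have h2 := P.lt_of_pos
  have : ((a : ℚ) * b - e) * (n - 1) < a := by
    by_contra! hle
    have h3 := mul_le_mul_of_nonneg_right hle h0.le
    have h4 : ((a : ℚ) * b - e) * ((n - 1) * θ) < (a * b - e) * 1 :=
      mul_lt_mul_of_pos_left h2 (by linarith)
    linarith
  exact_mod_cast this

/-- For `0 < θ < 1/2` the next best lower approximation after `1 / b` is `n / (n b - 1)`: in the
coordinates `(c, m)` it belongs to the least `c` with `m = 1`. -/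
lemma best_n (h0 : 0 < θ) (h : θ < 1 / 2) : BestPair α (n * b - 1) n := by
  have hn := P.three_le h0 h
  have hb := P.b_pos
  have hnb : 3 ≤ n * b := hn.trans (Nat.le_mul_of_pos_right n hb)
  have hcast : ((n * b - 1 : ℕ) : ℤ) = n * b - 1 := by
    rw [Nat.cast_sub (by omega)]; push_cast; rfl
  refine ⟨by omega, ?_, P.le_iff.2 ?_, fun a e he hed hae => ?_⟩
  · rw [← Nat.isCoprime_iff_coprime, hcast]
    exact ⟨b, -1, by ring⟩
  · have hcast' : ((n * b - 1 : ℕ) : ℚ) = n * b - 1 := by exact_mod_cast hcast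
    rw [hcast']
    linarith [P.one_le h0]
  · have hed' : (e : ℤ) < n * b - 1 := by rw [← hcast]; exact_mod_cast hed
    zify
    rw [hcast]
    by_cases hm : (1 : ℤ) ≤ a * b - e
    · have h1 := P.mul_pred_lt h0 hae hm
      set m : ℤ := a * b - e with hmdef
      have hn' : (3 : ℤ) ≤ n := by exact_mod_cast hn
      have hb' : (1 : ℤ) ≤ b := by exact_mod_cast hb
      suffices (n : ℤ) * m ≤ a by rw [hmdef] at this; linarith
      by_cases hm1 : m = 1
      · rw [hm1] at h1 ⊢
        linarith
      · -- here `e = a b - m` would be at least `n b - 1`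
        exfalso
        have hm2 : 2 ≤ m := by omega
        have h2 : (m - 1) * (n - 1) ≤ (a : ℤ) - n := by linarith
        have h3 : m - 1 ≤ (a : ℤ) - n := by nlinarith
        have h4 : (a : ℤ) - n ≤ (a - n) * b := by nlinarith
        linarith
    · nlinarith

/-- A best lower approximation with positive numerator is at least `1 / b`. -/
lemma best_ge {d c : ℕ} (h : BestPair α d c) (hc : 1 ≤ c) : d ≤ c * b := by
  rcases Nat.lt_or_ge b d with hbd | hbd
  · have := h.max 1 b P.b_pos hbd (by simpa using P.best_one.le)
    omega
  · exact hbd.trans (Nat.le_mul_of_pos_left b hc)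

lemma eq_of_best_one {d : ℕ} (h : BestPair α d 1) : d = b := by
  have h1 := P.best_ge h le_rfl
  have h2 := P.mul_lt_add le_rfl h.le one_pos
  omega

/-- For `0 < θ < 1/2` no best lower approximation lies strictly between `1 / b` and
`n / (n b - 1)`. -/
lemma best_ge_n (h0 : 0 < θ) (hθ : θ < 1 / 2) {d c : ℕ} (h : BestPair α d c) (hlt : d < c * b) :
    n * d ≤ c * (n * b - 1) := by
  have hn := P.three_le h0 hθ
  have hb := P.b_pos
  have hnb : 3 ≤ n * b := hn.trans (Nat.le_mul_of_pos_right n hb)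
  have hcast : ((n * b - 1 : ℕ) : ℤ) = n * b - 1 := by
    rw [Nat.cast_sub (by omega)]; push_cast; rfl
  rcases Nat.lt_or_ge (n * b - 1) d with hd | hd
  · exact h.max _ _ (by omega) hd (P.best_n h0 hθ).le
  have hm : (1 : ℤ) ≤ c * b - d := by
    have : (d : ℤ) < c * b := by exact_mod_cast hlt
    omega
  have h1 := P.mul_pred_lt h0 h.le hm
  have hd' : (d : ℤ) ≤ n * b - 1 := by rw [← hcast]; exact_mod_cast hd
  zify
  rw [hcast]
  set m : ℤ := c * b - d with hmdef
  have hn' : (3 : ℤ) ≤ n := by exact_mod_cast hn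
  have hb' : (1 : ℤ) ≤ b := by exact_mod_cast hb
  suffices (c : ℤ) ≤ n * m by rw [hmdef] at this; linarith
  by_contra! hlt'
  have h2 : m ≤ (c : ℤ) - n := by nlinarith
  have h3 : (c : ℤ) - n ≤ (c - n) * b := by nlinarith
  linarith

end Params

/-! ### The irreducible elements of the monoid of pole orders -/

/-- `(d, c)` is an admissible pair, i.e. `H⁰(dα(∞))` contains a function with polar divisor
`c(∞)`. -/
def Admissible (α : ℚ) (d c : ℕ) : Prop :=
  c ≠ 1 ∧ (c : ℚ) ≤ d * α

/-- The pairs `(d, c)` in the list of generators, in terms of `b = ⌈1/α⌉`, `θ = {-1/α}` and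
`n = ⌈1/θ⌉`. -/
inductive IsGenPair (α θ : ℚ) (b n : ℕ) : ℕ → ℕ → Prop
  | best {d c : ℕ} (h : BestPair α d c) (hc : c ≠ 1) : IsGenPair α θ b n d c
  | ord2 (h : θ < 1 / 2) : IsGenPair α θ b n (2 * b) 2
  | ord3_low (h : θ < 1 / 3) : IsGenPair α θ b n (3 * b) 3
  | ord3_high (h : 1 / 2 ≤ θ) (h' : θ < 2 / 3) : IsGenPair α θ b n (3 * b - 1) 3
  | sum12 (h : 0 < θ) (h' : θ < 1 / 2) : IsGenPair α θ b n ((n + 1) * b - 1) (n + 1)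

/-- `(d, c)` is the sum of two admissible pairs of positive degree. -/
def Splits (α : ℚ) (d c : ℕ) : Prop :=
  ∃ d₁ c₁ d₂ c₂ : ℕ, 0 < d₁ ∧ 0 < d₂ ∧ Admissible α d₁ c₁ ∧ Admissible α d₂ c₂ ∧
    d = d₁ + d₂ ∧ c = c₁ + c₂

namespace Params

variable {α θ : ℚ} {b n : ℕ} (P : Params α θ b n)
include P

/-- Admissible pairs in the coordinates `(c, m)`: every integer `m ≤ c θ` comes from a degree `d`. -/
lemma exists_degree {c : ℕ} (hc : 0 < c) {m : ℤ} (hm : (m : ℚ) ≤ c * θ) :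
    ∃ d : ℕ, 0 < d ∧ (d : ℤ) = c * b - m ∧ (c : ℚ) ≤ d * α := by
  have hpos : (0 : ℤ) < c * b - m := by
    have : (0 : ℚ) < c * b - m := by
      have h1 : (0 : ℚ) < c := by exact_mod_cast hc
      nlinarith [mul_pos h1 P.b_sub_pos]
    exact_mod_cast this
  have hd : (((c : ℤ) * b - m).toNat : ℤ) = c * b - m := Int.toNat_of_nonneg hpos.le
  refine ⟨_, by omega, hd, P.le_iff.2 ?_⟩
  have hd' : ((((c : ℤ) * b - m).toNat : ℕ) : ℚ) = c * b - m := by exact_mod_cast hd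
  rw [hd']
  linarith

/-- A splitting in the coordinates `(c, m)` with `m = c b - d`. -/
lemma splits_of_le {d c k : ℕ} {m l : ℤ} (hd : (d : ℤ) = c * b - m) (hk : 2 ≤ k)
    (hkc : k + 2 ≤ c) (hl : (l : ℚ) ≤ k * θ) (hml : (m : ℚ) - l ≤ (c - k) * θ) :
    Splits α d c := by
  obtain ⟨j, rfl⟩ : ∃ j, c = k + j := ⟨c - k, by omega⟩
  obtain ⟨d₁, h1, h1', h1''⟩ := P.exists_degree (c := k) (by omega) hl
  obtain ⟨d₂, h2, h2', h2''⟩ := P.exists_degree (c := j) (m := m - l) (by omega) (by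
    push_cast at hml ⊢
    linarith)
  refine ⟨d₁, k, d₂, j, h1, h2, ⟨by omega, h1''⟩, ⟨by omega, h2''⟩, ?_, rfl⟩
  push_cast at hd
  have : (d : ℤ) = d₁ + d₂ := by rw [hd, h1', h2']; ring
  exact_mod_cast this

/-- The case `c = 2` or `c = 3` of minimal degree: such a pair is always in the list. -/
lemma isGenPair_of_le_three {d c : ℕ} (hc : c = 2 ∨ c = 3) (h1 : (c : ℚ) * b - d ≤ c * θ)
    (h2 : (c : ℚ) * θ < c * b - d + 1) : IsGenPair α θ b n d c := by
  have key : ∀ M : ℕ, (M : ℚ) ≤ c * θ → (c : ℚ) * θ < M + 1 → d + M = c * b := by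
    intro M hM hM'
    have e1 : ((c * b : ℕ) : ℚ) < ((d + M + 1 : ℕ) : ℚ) := by push_cast; linarith
    have e2 : ((d + M : ℕ) : ℚ) < ((c * b + 1 : ℕ) : ℚ) := by push_cast; linarith
    rw [Nat.cast_lt] at e1 e2
    omega
  have h0 := P.nonneg
  have hlt := P.lt_one
  rcases hc with rfl | rfl
  · rcases lt_or_ge θ (1 / 2) with h | h
    · have := key 0 (by push_cast; linarith) (by push_cast; linarith)
      rw [show d = 2 * b by omega]
      exact .ord2 h
    · have := key 1 (by push_cast; linarith) (by push_cast; linarith)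
      rw [show d = 2 * b - 1 by omega]
      exact .best (P.best_two h) (by norm_num)
  · rcases lt_or_ge θ (1 / 3) with h | h
    · have := key 0 (by push_cast; linarith) (by push_cast; linarith)
      rw [show d = 3 * b by omega]
      exact .ord3_low h
    rcases lt_or_ge θ (1 / 2) with h' | h'
    · have := key 1 (by push_cast; linarith) (by push_cast; linarith)
      rw [show d = 3 * b - 1 by omega]
      have hθ : 0 < θ := by linarith
      have hn := P.three_le hθ h'
      have hn' : n = 3 := by
        have := P.lt_of_pos
        have : (n : ℚ) < 4 := by nlinarith
        have : n < 4 := by exact_mod_cast this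
        omega
      subst hn'
      exact .best (P.best_n hθ h') (by norm_num)
    rcases lt_or_ge θ (2 / 3) with h'' | h''
    · have := key 1 (by push_cast; linarith) (by push_cast; linarith)
      rw [show d = 3 * b - 1 by omega]
      exact .ord3_high h' h''
    · have := key 2 (by push_cast; linarith) (by push_cast; linarith)
      rw [show d = 3 * b - 2 by omega]
      exact .best (P.best_three h'') (by norm_num)

/-- The case in which only the inadmissible pair `(b, 1)` can be split off at first sight, that is,
`m ≤ (c - 1) θ`. One splits off `(2b - 1, 2)`, `(2b, 2)` or `(n b - 1, n)` instead; the last choice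
leaves a remainder with `c = 1` exactly for the pair `((n + 1) b - 1, n + 1)`. -/
lemma isGenPair_or_splits_of_pred {d c : ℕ} (hc : 4 ≤ c)
    (h : (c : ℚ) * b - d ≤ (c - 1) * θ) : IsGenPair α θ b n d c ∨ Splits α d c := by
  have h0 := P.nonneg
  have hlt := P.lt_one
  have hc' : (4 : ℚ) ≤ c := by exact_mod_cast hc
  obtain ⟨m, hm⟩ : ∃ m : ℤ, (d : ℤ) = c * b - m := ⟨c * b - d, by ring⟩
  have hm' : (d : ℚ) = c * b - m := by exact_mod_cast hm
  have h : (m : ℚ) ≤ (c - 1) * θ := by rw [hm'] at h; linarith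
  rcases le_or_gt (1 / 2) θ with hθ | hθ
  · exact Or.inr (P.splits_of_le (k := 2) (l := 1) hm le_rfl hc (by push_cast; linarith)
      (by push_cast; linarith))
  rcases le_or_gt m 0 with hm0 | hm0
  · have : (m : ℚ) ≤ 0 := by exact_mod_cast hm0
    refine Or.inr (P.splits_of_le (k := 2) (l := 0) hm le_rfl hc (by push_cast; linarith) ?_)
    push_cast
    nlinarith
  have hm1 : (1 : ℚ) ≤ m := by exact_mod_cast hm0
  have hpos : 0 < θ := by
    by_contra! hle
    nlinarith
  have hn := P.three_le hpos hθ
  have hnθ := P.lt_of_pos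
  have hcn : n + 1 ≤ c := by
    have h1 : ((n : ℚ) - 1) * θ < (c - 1) * θ := by linarith
    have h2 := lt_of_mul_lt_mul_right h1 hpos.le
    have h3 : (n : ℚ) < c := by linarith
    exact_mod_cast h3
  rcases Nat.eq_or_lt_of_le hcn with rfl | hcn
  · left
    have hm2 : m < 2 := by
      have : (m : ℚ) < 2 := by push_cast at h; linarith
      exact_mod_cast this
    have hm1 : m = 1 := by omega
    have hd : d = (n + 1) * b - 1 := by
      have : (d : ℤ) + 1 = ((n + 1) * b : ℕ) := by rw [hm, hm1]; push_cast; ring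
      omega
    rw [hd]
    exact .sum12 hpos hθ
  · right
    refine P.splits_of_le (k := n) (l := 1) hm (by omega) hcn (by
      push_cast; exact P.one_le hpos) ?_
    push_cast
    linarith

/-- Every nonzero admissible pair outside the list is a sum of two nonzero admissible pairs. -/
lemma isGenPair_or_splits {d c : ℕ} (hd : 0 < d) (h : Admissible α d c) :
    IsGenPair α θ b n d c ∨ Splits α d c := by
  obtain ⟨hc1, hle⟩ := h
  have hα := P.pos
  rcases Nat.eq_zero_or_pos c with rfl | hc0
  · rcases Nat.eq_or_lt_of_le (show 1 ≤ d from hd) with rfl | hd1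
    · exact Or.inl (.best P.best_zero (by norm_num))
    · refine Or.inr ⟨1, 0, d - 1, 0, one_pos, by omega, ⟨by norm_num, ?_⟩, ⟨by norm_num, ?_⟩,
        by omega, rfl⟩ <;> simp [hα.le]
      positivity
  have hc0' : (0 : ℚ) < c := by exact_mod_cast hc0
  obtain ⟨e, rfl⟩ : ∃ e, d = e + 1 := ⟨d - 1, by omega⟩
  by_cases hmin : (c : ℚ) ≤ e * α
  · have he : 0 < e := by
      rcases Nat.eq_zero_or_pos e with rfl | he
      · simp at hmin
        omega
      · exact he
    exact Or.inr ⟨1, 0, e, c, one_pos, he, ⟨by norm_num, by simp [hα.le]⟩, ⟨hc1, hmin⟩,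
      by omega, by omega⟩
  rcases Nat.lt_or_ge c 4 with hc4 | hc4
  · left
    refine P.isGenPair_of_le_three (by omega) (P.le_iff.1 hle) ?_
    rw [P.le_iff] at hmin
    push_cast
    linarith
  push Not at hmin
  set d := e + 1 with hde
  have hd' : (0 : ℚ) < d := by exact_mod_cast hd
  by_cases hcop : Nat.Coprime c d
  · by_cases hbest : BestPair α d c
    · exact Or.inl (.best hbest hc1)
    have : ∃ a i : ℕ, 0 < i ∧ i < d ∧ (a : ℚ) ≤ i * α ∧ c * i < a * d := by
      by_contra! hall
      exact hbest ⟨hd, hcop, hle, hall⟩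
    obtain ⟨a, i, hi, hid, hai, hlt⟩ := this
    have hie : (i : ℚ) ≤ e := by exact_mod_cast Nat.lt_succ_iff.1 hid
    have hac : a < c := by
      have : (a : ℚ) < c := by nlinarith
      exact_mod_cast this
    have ha0 : a ≠ 0 := by
      rintro rfl
      simp at hlt
    have ha1 : a ≠ 1 := by
      rintro rfl
      have h1 : ((c * i : ℕ) : ℚ) ≤ e := by
        have : c * i ≤ e := by omega
        exact_mod_cast this
      push_cast at h1 hai
      nlinarith [mul_le_mul_of_nonneg_left hai hc0'.le]
    -- the rest `(d - i, c - a)` lies below the line as well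
    have hrest : ((c - a : ℕ) : ℚ) ≤ ((d - i : ℕ) : ℚ) * α := by
      rw [Nat.cast_sub hac.le, Nat.cast_sub hid.le]
      have h1 : (c : ℚ) * i < a * d := by exact_mod_cast hlt
      have h2 : (i : ℚ) < d := by exact_mod_cast hid
      refine le_of_mul_le_mul_right ?_ hd'
      nlinarith [mul_le_mul_of_nonneg_left hle (sub_pos.2 h2).le]
    by_cases hca : c - a = 1
    · refine P.isGenPair_or_splits_of_pred hc4 ?_
      rw [hca] at hrest
      have h1 := P.mul_lt_add le_rfl hrest one_pos
      have h2 : ((c - 1 : ℕ) : ℚ) ≤ ((d - b : ℕ) : ℚ) * α := by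
        rw [show c - 1 = a by omega]
        refine hai.trans (mul_le_mul_of_nonneg_right ?_ hα.le)
        exact_mod_cast (by omega : i ≤ d - b)
      rw [P.le_iff, Nat.cast_sub (by omega), Nat.cast_sub (by omega)] at h2
      push_cast at h2 ⊢
      linarith
    · exact Or.inr ⟨i, a, d - i, c - a, hi, by omega, ⟨ha1, hai⟩, ⟨hca, hrest⟩, by omega,
        by omega⟩
  · right
    obtain ⟨g, hg, ⟨c', hc'⟩, ⟨d', hd'⟩⟩ : ∃ g, 2 ≤ g ∧ g ∣ c ∧ g ∣ d := by
      refine ⟨Nat.gcd c d, ?_, Nat.gcd_dvd_left .., Nat.gcd_dvd_right ..⟩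
      have : Nat.gcd c d ≠ 0 := Nat.gcd_ne_zero_left hc0.ne'
      have : Nat.gcd c d ≠ 1 := hcop
      omega
    have hd0 : 0 < d' := by
      rcases Nat.eq_zero_or_pos d' with rfl | h
      · omega
      · exact h
    have hle' : (c' : ℚ) ≤ d' * α := by
      rw [hc', hd'] at hle
      push_cast at hle
      have : (0 : ℚ) < g := by exact_mod_cast (by omega : 0 < g)
      rw [mul_assoc] at hle
      exact le_of_mul_le_mul_left hle this
    have hmul : ∀ j : ℕ, ((j * c' : ℕ) : ℚ) ≤ (j * d' : ℕ) * α := by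
      intro j
      push_cast
      rw [mul_assoc]
      exact mul_le_mul_of_nonneg_left hle' (by positivity)
    by_cases h1 : c' = 1
    · subst h1
      obtain ⟨j, rfl⟩ : ∃ j, g = j + 4 := ⟨g - 4, by omega⟩
      exact ⟨2 * d', 2 * 1, (j + 2) * d', (j + 2) * 1, by omega, by positivity,
        ⟨by omega, hmul _⟩, ⟨by omega, hmul _⟩, by rw [hd']; ring, by rw [hc']; ring⟩
    · have hc0 : c' ≠ 0 := by
        rintro rfl
        omega
      obtain ⟨j, rfl⟩ : ∃ j, g = j + 2 := ⟨g - 2, by omega⟩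
      have hj : c' ≤ (j + 1) * c' := Nat.le_mul_of_pos_left _ (by omega)
      exact ⟨1 * d', 1 * c', (j + 1) * d', (j + 1) * c', by omega, by positivity,
        ⟨by omega, hmul _⟩, ⟨by omega, hmul _⟩, by rw [hd']; ring, by rw [hc']; ring⟩

end Params

/-! ### Decompositions of the pairs in the list -/

/-- Both summands have slope less than `c / d`, by the maximality of `c / d` and because it is in
lowest terms. -/
lemma BestPair.add_lt {α : ℚ} {d c i j e f : ℕ} (h : BestPair α d c) (hi : 0 < i)
    (hj : 0 < j) (hij : i + j = d)
    (he : (e : ℚ) ≤ i * α) (hf : (f : ℚ) ≤ j * α) : e + f < c := by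
  have key : ∀ i e : ℕ, 0 < i → i < d → (e : ℚ) ≤ i * α → e * d < c * i := by
    intro i e hi hid he
    refine lt_of_le_of_ne (h.max e i hi hid he) fun heq => ?_
    have := h.coprime.symm.dvd_of_dvd_mul_left (Dvd.intro_left e heq)
    exact absurd (Nat.le_of_dvd hi this) (by omega)
  have h1 := key i e hi (by omega) he
  have h2 := key j f hj (by omega) hf
  refine lt_of_mul_lt_mul_right (a := d) ?_ d.zero_le
  rw [add_mul]
  conv_rhs => rw [← hij]
  rw [mul_add]
  omega

namespace Params

variable {α θ : ℚ} {b n : ℕ} (P : Params α θ b n)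
include P

/-- The bound on the denominator of `a / e ≤ α` that follows from `θ < p / q`. -/
lemma mul_lt_of_mul_lt {p q a e : ℕ} (hθ : q * θ < p) (h : (a : ℚ) ≤ e * α) (hq : 0 < q)
    (ha : 0 < a) : q * (a * b) < q * e + p * a := by
  have h1 := P.mul_sub_le h
  have ha' : (0 : ℚ) < a := by exact_mod_cast ha
  have hq' : (0 : ℚ) < q := by exact_mod_cast hq
  have h2 := mul_lt_mul_of_pos_left hθ ha'
  have h3 := mul_le_mul_of_nonneg_left h1 hq'.le
  have : ((q * (a * b) : ℕ) : ℚ) < ((q * e + p * a : ℕ) : ℚ) := by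
    push_cast
    linarith
  exact_mod_cast this

lemma lt_of_ord2 {i j e f : ℕ} (h : θ < 1 / 2) (hi : 0 < i) (hj : 0 < j) (hij : i + j = 2 * b)
    (he : Admissible α i e) (hf : Admissible α j f) : e + f < 2 := by
  have hb := P.b_pos
  by_contra! hle
  obtain ⟨t, ht⟩ : ∃ t, e + f = 2 + t := ⟨e + f - 2, by omega⟩
  have hθ : ((2 : ℕ) : ℚ) * θ < (1 : ℕ) := by push_cast; linarith
  have hsum := P.mul_lt_of_mul_lt (a := e + f) (e := i + j) hθ (by
    push_cast
    linarith [he.2, hf.2]) two_pos (by omega)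
  rw [ht, hij] at hsum
  have htb : t ≤ t * b := Nat.le_mul_of_pos_right t hb
  have ht2 : t < 2 := by
    rw [add_mul] at hsum
    omega
  have h1 := fun h0 => P.mul_lt_of_mul_lt hθ he.2 two_pos h0
  have h2 := fun h0 => P.mul_lt_of_mul_lt hθ hf.2 two_pos h0
  have he1 := he.1
  have hf1 := hf.1
  have he4 : e < 4 := by omega
  have hf4 : f < 4 := by omega
  clear he hf
  interval_cases e <;> interval_cases f <;> omega

lemma lt_of_ord3_low {i j e f : ℕ} (h : θ < 1 / 3) (hi : 0 < i) (hj : 0 < j)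
    (hij : i + j = 3 * b) (he : Admissible α i e) (hf : Admissible α j f) : e + f < 3 := by
  have hb := P.b_pos
  by_contra! hle
  obtain ⟨t, ht⟩ : ∃ t, e + f = 3 + t := ⟨e + f - 3, by omega⟩
  have hθ : ((3 : ℕ) : ℚ) * θ < (1 : ℕ) := by push_cast; linarith
  have hsum := P.mul_lt_of_mul_lt (a := e + f) (e := i + j) hθ (by
    push_cast
    linarith [he.2, hf.2]) three_pos (by omega)
  rw [ht, hij] at hsum
  have htb : t ≤ t * b := Nat.le_mul_of_pos_right t hb
  have ht2 : t < 2 := by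
    rw [add_mul] at hsum
    omega
  have h1 := fun h0 => P.mul_lt_of_mul_lt hθ he.2 three_pos h0
  have h2 := fun h0 => P.mul_lt_of_mul_lt hθ hf.2 three_pos h0
  have he1 := he.1
  have hf1 := hf.1
  have he4 : e < 5 := by omega
  have hf4 : f < 5 := by omega
  clear he hf
  interval_cases e <;> interval_cases f <;> omega

/-- The only pair in the list for which a product of functions of smaller degree has a larger pole
order is `(2, 3)` for `2 ≤ α < 3`. -/
lemma lt_of_ord3_high {i j e f : ℕ} (h : θ < 2 / 3) (hi : 0 < i) (hj : 0 < j)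
    (hij : i + j = 3 * b - 1) (he : Admissible α i e) (hf : Admissible α j f) :
    e + f < 3 ∨ (b = 1 ∧ e = 2 ∧ f = 2) := by
  have hb := P.b_pos
  by_contra! hle
  obtain ⟨hle, hle'⟩ := hle
  obtain ⟨t, ht⟩ : ∃ t, e + f = 3 + t := ⟨e + f - 3, by omega⟩
  have hθ : ((3 : ℕ) : ℚ) * θ < (2 : ℕ) := by push_cast; linarith
  have hsum := P.mul_lt_of_mul_lt (a := e + f) (e := i + j) hθ (by
    push_cast
    linarith [he.2, hf.2]) three_pos (by omega)
  rw [ht, hij] at hsum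
  have htb : t ≤ t * b := Nat.le_mul_of_pos_right t hb
  have ht2 : t < 3 := by
    rw [add_mul] at hsum
    omega
  have h1 := fun h0 => P.mul_lt_of_mul_lt hθ he.2 three_pos h0
  have h2 := fun h0 => P.mul_lt_of_mul_lt hθ hf.2 three_pos h0
  have he1 := he.1
  have hf1 := hf.1
  have he4 : e < 6 := by omega
  have hf4 : f < 6 := by omega
  clear he hf
  interval_cases e <;> interval_cases f <;> omega

/-- The pair `((n + 1) b - 1, n + 1)` is irreducible: `m = 1` for it, so that one summand would have
`m ≥ 1` and hence `c ≥ n`, and the other one would have `c ≤ 1`. -/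
lemma false_of_sum_eq {i j e f : ℕ} (h0 : 0 < θ) (h : θ < 1 / 2) (hj : 0 < j)
    (hij : i + j = (n + 1) * b - 1) (he : Admissible α i e) (hf : Admissible α j f)
    (hef : e + f = n + 1) (hlt : i < e * b) : False := by
  have hn := P.three_le h0 h
  have hm : (1 : ℤ) ≤ e * b - i := by
    have : (i : ℤ) < e * b := by exact_mod_cast hlt
    omega
  have h1 := P.mul_pred_lt h0 he.2 hm
  have hne : n ≤ e := by
    have h2 : (n : ℤ) - 1 ≤ (e * b - i) * (n - 1) := by
      have : (0 : ℤ) ≤ n - 1 := by omega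
      nlinarith
    omega
  have hf1 := hf.1
  obtain rfl : f = 0 := by omega
  obtain rfl : e = n + 1 := by omega
  have h3 : ((n + 1 : ℕ) : ℚ) * b - i ≤ (n + 1 : ℕ) * θ := P.le_iff.1 he.2
  have h4 : ((n + 1 : ℕ) : ℚ) * θ < 2 := by
    push_cast
    linarith [P.lt_of_pos]
  have h5 : (((n + 1) * b : ℕ) : ℚ) < ((i + 2 : ℕ) : ℚ) := by
    push_cast at h3 h4 ⊢
    linarith
  have h6 : (n + 1) * b < i + 2 := by exact_mod_cast h5
  omega

lemma lt_of_sum12 {i j e f : ℕ} (h0 : 0 < θ) (h : θ < 1 / 2) (hi : 0 < i) (hj : 0 < j)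
    (hij : i + j = (n + 1) * b - 1) (he : Admissible α i e) (hf : Admissible α j f) :
    e + f < n + 1 := by
  have hn := P.three_le h0 h
  have hb := P.b_pos
  by_contra! hle
  obtain ⟨t, ht⟩ : ∃ t, e + f = n + 1 + t := ⟨e + f - (n + 1), by omega⟩
  have htb : t ≤ t * b := Nat.le_mul_of_pos_right t hb
  have hnb : n + 1 ≤ (n + 1) * b := Nat.le_mul_of_pos_right _ hb
  have hθ : ((n - 1 : ℕ) : ℚ) * θ < (1 : ℕ) := by
    rw [Nat.cast_sub (by omega)]
    simpa using P.lt_of_pos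
  have hsum := P.mul_lt_of_mul_lt (a := e + f) (e := i + j) hθ (by
    push_cast
    linarith [he.2, hf.2]) (by omega) (by omega)
  have hkey : (n - 1) * (t + 1) < n + 1 + t := by
    have h1 : (e + f) * b = (i + j) + (t * b + 1) := by
      rw [ht, hij, add_mul (n + 1) t b]
      omega
    rw [h1, mul_add] at hsum
    have h2 : (n - 1) * (t + 1) ≤ (n - 1) * (t * b + 1) := Nat.mul_le_mul_left _ (by omega)
    omega
  obtain ⟨l, rfl⟩ : ∃ l, n = l + 3 := ⟨n - 3, by omega⟩
  have hkey' : (l + 1) * t < 2 := by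
    have : (l + 3 - 1) * (t + 1) = (l + 1) * t + t + l + 2 := by
      rw [show l + 3 - 1 = l + 2 by omega]
      ring
    omega
  rcases Nat.eq_zero_or_pos t with rfl | ht0
  · rcases Nat.lt_or_ge i (e * b) with hlt | hge
    · exact P.false_of_sum_eq h0 h hj hij he hf ht hlt
    · refine P.false_of_sum_eq h0 h hi (by omega) hf he (by omega) (j := i) ?_
      have h1 : (e + f) * b = (l + 3 + 1) * b := by rw [ht]
      rw [add_mul] at h1
      omega
  · have hl : l + 1 ≤ (l + 1) * t := Nat.le_mul_of_pos_right _ ht0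
    obtain rfl : l = 0 := by omega
    obtain rfl : t = 1 := by omega
    have hθ : ((2 : ℕ) : ℚ) * θ < (1 : ℕ) := by push_cast; linarith
    have h1 := fun h0 => P.mul_lt_of_mul_lt hθ he.2 two_pos h0
    have h2 := fun h0 => P.mul_lt_of_mul_lt hθ hf.2 two_pos h0
    have h3 := P.mul_lt_of_mul_lt (a := e + f) (e := i + j) hθ (by
      push_cast
      linarith [he.2, hf.2]) two_pos (by omega)
    have he1 := he.1
    have hf1 := hf.1
    have he4 : e < 6 := by omega
    have hf4 : f < 6 := by omega
    rw [ht] at h3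
    clear he hf
    interval_cases e <;> interval_cases f <;> omega

/-- The pairs in the list are irreducible, and apart from one exception a sum of two admissible
pairs of the same total degree has a smaller second component. -/
lemma lt_of_isGenPair {d c i j e f : ℕ} (h : IsGenPair α θ b n d c) (hi : 0 < i) (hj : 0 < j)
    (hij : i + j = d) (he : Admissible α i e) (hf : Admissible α j f) :
    e + f < c ∨ (d = 2 ∧ c = 3 ∧ e = 2 ∧ f = 2) := by
  cases h with
  | best h _ => exact Or.inl (h.add_lt hi hj hij he.2 hf.2)
  | ord2 h => exact Or.inl (P.lt_of_ord2 h hi hj hij he hf)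
  | ord3_low h => exact Or.inl (P.lt_of_ord3_low h hi hj hij he hf)
  | ord3_high _ h =>
    rcases P.lt_of_ord3_high h hi hj hij he hf with h | ⟨rfl, he, hf⟩
    · exact Or.inl h
    · exact Or.inr ⟨rfl, rfl, he, hf⟩
  | sum12 h0 h => exact Or.inl (P.lt_of_sum12 h0 h hi hj hij he hf)

lemma isGenPair_admissible {d c : ℕ} (h : IsGenPair α θ b n d c) : Admissible α d c := by
  have h0 := P.nonneg
  have hb := P.b_pos
  cases h with
  | best h hc => exact ⟨hc, h.le⟩
  | ord2 h => exact ⟨by norm_num, P.le_iff.2 (by push_cast; linarith)⟩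
  | ord3_low h => exact ⟨by norm_num, P.le_iff.2 (by push_cast; linarith)⟩
  | ord3_high h _ =>
    refine ⟨by norm_num, P.le_iff.2 ?_⟩
    rw [Nat.cast_sub (by omega)]
    push_cast
    linarith
  | sum12 h0 h =>
    have := P.three_le h0 h
    have hnb : n + 1 ≤ (n + 1) * b := Nat.le_mul_of_pos_right _ hb
    refine ⟨by omega, P.le_iff.2 ?_⟩
    rw [Nat.cast_sub (by omega)]
    push_cast
    linarith [P.one_le h0]

lemma isGenPair_pos {d c : ℕ} (h : IsGenPair α θ b n d c) : 0 < d := by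
  have hb := P.b_pos
  cases h with
  | best h hc => exact h.pos
  | sum12 h0 h =>
    have := P.three_le h0 h
    have hnb : n + 1 ≤ (n + 1) * b := Nat.le_mul_of_pos_right _ hb
    omega
  | _ => omega

end Params

/-! ### The sequence of best lower approximations -/

lemma exists_strictMonoOn_image_eq {β : Type*} [LinearOrder β] (F : Finset β) (hF : F.Nonempty) :
    ∃ (r : ℕ) (q : ℕ → β), StrictMonoOn q (Set.Iic r) ∧ q '' Set.Iic r = F := by
  obtain ⟨r, hr⟩ : ∃ r, F.card = r + 1 := ⟨F.card - 1, by have := hF.card_pos; omega⟩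
  refine ⟨r, fun i => F.orderEmbOfFin hr ⟨min i r, by omega⟩, ?_, ?_⟩
  · intro i hi j hj hij
    simp only [Set.mem_Iic] at hi hj
    simpa [OrderEmbedding.lt_iff_lt, Fin.lt_def, hi, hj] using hij
  · rw [← F.range_orderEmbOfFin hr]
    ext x
    constructor
    · rintro ⟨i, -, rfl⟩
      exact ⟨_, rfl⟩
    · rintro ⟨i, rfl⟩
      refine ⟨i, Nat.lt_succ_iff.1 i.2, ?_⟩
      refine congrArg (F.orderEmbOfFin hr) (Fin.ext ?_)
      exact min_eq_left (Nat.lt_succ_iff.1 i.2)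

lemma finite_isBestLowerApprox (α : ℚ) : {s | 0 ≤ s ∧ IsBestLowerApprox α s}.Finite := by
  refine Set.Finite.subset ((Finset.range (α.num.toNat + 1) ×ˢ Finset.range (α.den + 1)).image
    fun p : ℕ × ℕ => (p.1 : ℚ) / p.2).finite_toSet ?_
  rintro s ⟨hs, hle, hs'⟩
  have hden : s.den ≤ α.den := by
    rcases hle.eq_or_lt with rfl | hlt
    · exact le_rfl
    · exact hs' α hlt le_rfl
  refine Finset.mem_coe.2 (Finset.mem_image.2 ⟨(s.num.toNat, s.den), ?_, num_toNat_div_den hs⟩)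
  rw [Finset.mem_product, Finset.mem_range, Finset.mem_range]
  refine ⟨Nat.lt_succ_iff.2 ?_, Nat.lt_succ_iff.2 hden⟩
  have h1 : (s.num.toNat : ℚ) ≤ α.num.toNat := by
    have e1 := num_toNat_div_den hs
    have e2 := num_toNat_div_den (hs.trans hle)
    have p1 : (0 : ℚ) < s.den := by exact_mod_cast s.den_pos
    have p2 : (0 : ℚ) < α.den := by exact_mod_cast α.den_pos
    rw [div_eq_iff p1.ne'] at e1
    rw [div_eq_iff p2.ne'] at e2
    rw [e1, e2]
    exact mul_le_mul hle (by exact_mod_cast hden) p1.le (hs.trans hle)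
  exact_mod_cast h1

lemma isBestLowerApprox_self (α : ℚ) : IsBestLowerApprox α α :=
  ⟨le_rfl, fun _ h h' => absurd h (not_lt.2 h')⟩

lemma exists_isBestLowerSeq {α : ℚ} (hα : 0 < α) : ∃ r q, IsBestLowerSeq α r q := by
  obtain ⟨r, q, h1, h2⟩ := exists_strictMonoOn_image_eq (finite_isBestLowerApprox α).toFinset
    ⟨α, by simpa using ⟨hα.le, isBestLowerApprox_self α⟩⟩
  exact ⟨r, q, h1, by simpa using h2⟩

namespace IsBestLowerSeq

variable {α : ℚ} {r : ℕ} {q : ℕ → ℚ} (h : IsBestLowerSeq α r q)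
include h

lemma mem {i : ℕ} (hi : i ≤ r) : 0 ≤ q i ∧ IsBestLowerApprox α (q i) := by
  have : q i ∈ q '' Set.Iic r := ⟨i, hi, rfl⟩
  rwa [h.2] at this

lemma exists_eq {s : ℚ} (h0 : 0 ≤ s) (hs : IsBestLowerApprox α s) : ∃ i ≤ r, q i = s := by
  have : s ∈ q '' Set.Iic r := by
    rw [h.2]
    exact ⟨h0, hs⟩
  exact this

lemma bestPair {i : ℕ} (hi : i ≤ r) : BestPair α (q i).den (q i).num.toNat :=
  (isBestLowerApprox_iff (h.mem hi).1).1 (h.mem hi).2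

lemma injOn {i j : ℕ} (hi : i ≤ r) (hj : j ≤ r) (hij : q i = q j) : i = j :=
  h.1.injOn hi hj hij

lemma exists_pair_eq {d c : ℕ} (hp : BestPair α d c) :
    ∃ i ≤ r, (q i).den = d ∧ (q i).num.toNat = c := by
  obtain ⟨i, hi, hq⟩ := h.exists_eq (by positivity) hp.isBestLowerApprox
  exact ⟨i, hi, hq ▸ num_den_of_coprime hp.pos hp.coprime⟩

lemma last_eq (hα : 0 < α) : q r = α := by
  obtain ⟨i, hi, hq⟩ := h.exists_eq hα.le (isBestLowerApprox_self α)
  refine le_antisymm (h.mem le_rfl).2.1 ?_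
  rw [← hq]
  exact h.1.monotoneOn hi (Set.mem_Iic.2 le_rfl) hi

/-- The term after `q i` is the least best lower approximation exceeding `q i`. -/
lemma eq_succ {i : ℕ} (hi : i ≤ r) {s : ℚ} (hs : IsBestLowerApprox α s) (hlt : q i < s)
    (hgap : ∀ x, IsBestLowerApprox α x → q i < x → s ≤ x) : i + 1 ≤ r ∧ q (i + 1) = s := by
  obtain ⟨j, hj, rfl⟩ := h.exists_eq ((h.mem hi).1.trans hlt.le) hs
  have hij : i < j := (h.1.lt_iff_lt hi hj).1 hlt
  have hi1 : i + 1 ≤ r := le_trans hij hj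
  refine ⟨hi1, le_antisymm (h.1.monotoneOn hi1 hj hij) ?_⟩
  exact hgap _ (h.mem hi1).2 (h.1 hi hi1 i.lt_succ_self)

variable {θ : ℚ} {b n : ℕ} (P : Params α θ b n)
include P

lemma zero_eq : q 0 = 0 := by
  have h0 := P.best_zero.isBestLowerApprox
  obtain ⟨i, hi, hq⟩ := h.exists_eq le_rfl (s := 0) (by simpa using h0)
  refine le_antisymm ?_ (h.mem r.zero_le).1
  rw [← hq]
  exact h.1.monotoneOn r.zero_le hi i.zero_le

lemma one_eq : 1 ≤ r ∧ q 1 = 1 / b := by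
  have hb : (0 : ℚ) < b := by exact_mod_cast P.b_pos
  have h1 : IsBestLowerApprox α (1 / b) := by simpa using P.best_one.isBestLowerApprox
  have := h.eq_succ (i := 0) r.zero_le h1 (by rw [h.zero_eq P]; positivity) fun x hx hx0 => ?_
  · simpa using this
  · rw [h.zero_eq P] at hx0
    have hp := (isBestLowerApprox_iff hx0.le).1 hx
    have hnum : 0 < x.num := Rat.num_pos.2 hx0
    have hle := P.best_ge hp (by omega)
    rw [← num_toNat_div_den hx0.le, div_le_div_iff₀ hb (by exact_mod_cast hp.pos), one_mul]
    exact_mod_cast hle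

lemma num_eq_one_iff {i : ℕ} (hi : i ≤ r) : (q i).num = 1 ↔ i = 1 := by
  obtain ⟨hr, h1⟩ := h.one_eq P
  constructor
  · intro hnum
    have hp := h.bestPair hi
    rw [hnum] at hp
    refine h.injOn hi hr ?_
    rw [h1, ← Rat.num_div_den (q i), P.eq_of_best_one hp, hnum]
    simp
  · rintro rfl
    have := (num_den_of_coprime (c := 1) P.b_pos (by simp)).2
    rw [Nat.cast_one, ← h1] at this
    omega

lemma pair_one : (q 1).den = b ∧ (q 1).num.toNat = 1 := by
  rw [(h.one_eq P).2]
  simpa using num_den_of_coprime (c := 1) P.b_pos (by simp)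

lemma two_eq (h0 : 0 < θ) (hθ : θ < 1 / 2) :
    2 ≤ r ∧ (q 2).den = n * b - 1 ∧ (q 2).num.toNat = n := by
  have hb : (0 : ℚ) < b := by exact_mod_cast P.b_pos
  have hbest := P.best_n h0 hθ
  obtain ⟨hr, h1⟩ := h.one_eq P
  have hd : (0 : ℚ) < (n * b - 1 : ℕ) := by exact_mod_cast hbest.pos
  have hlt : n * b - 1 < n * b := by have := hbest.pos; omega
  have := h.eq_succ hr hbest.isBestLowerApprox (by
    rw [h1, div_lt_div_iff₀ hb hd, one_mul]
    exact_mod_cast hlt) fun x hx hx0 => ?_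
  · refine ⟨this.1, ?_⟩
    rw [this.2]
    exact num_den_of_coprime hbest.pos hbest.coprime
  · have hx0' : 0 ≤ x := (h.mem hr).1.trans hx0.le
    have hp := (isBestLowerApprox_iff hx0').1 hx
    have hxd : (0 : ℚ) < x.den := by exact_mod_cast hp.pos
    rw [h1, ← num_toNat_div_den hx0', div_lt_div_iff₀ hb hxd, one_mul] at hx0
    have hle := P.best_ge_n h0 hθ hp (by exact_mod_cast hx0)
    rw [← num_toNat_div_den hx0', div_le_div_iff₀ hd hxd]
    exact_mod_cast hle

end IsBestLowerSeq

lemma exists_params {α : ℚ} (hα : 0 < α) : ∃ b n, Params α (Int.fract (-1 / α)) b n := by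
  set θ := Int.fract (-1 / α) with hθ
  have hb : ((⌈1 / α⌉₊ : ℕ) : ℚ) - θ = 1 / α := by
    have h1 : ((⌈1 / α⌉₊ : ℕ) : ℚ) = (⌈1 / α⌉ : ℤ) := by
      rw [← Int.natCast_ceil_eq_ceil (by positivity)]
      rfl
    rw [h1, hθ, Int.fract, neg_div, Int.floor_neg]
    push_cast
    ring
  have h0 : 0 ≤ θ := Int.fract_nonneg _
  refine ⟨⌈1 / α⌉₊, ⌈1 / θ⌉₊, hα, by rw [hb]; field_simp, h0, Int.fract_lt_one _,
    fun hpos => ?_, ?_⟩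
  · rw [← div_le_iff₀ hpos]
    exact Nat.le_ceil _
  · rcases h0.eq_or_lt with h | hpos
    · rw [← h]
      simp
    · rw [← lt_div_iff₀ hpos]
      linarith [Nat.ceil_lt_add_one (show 0 ≤ 1 / θ by positivity)]

/-! ### The labels of the generators -/

namespace GenIndex

variable {α : ℚ} {b n r : ℕ} {q : ℕ → ℚ}

lemma ceil_div_eq (P : Params α (Int.fract (-1 / α)) b n) {c M : ℕ}
    (h1 : (M : ℚ) ≤ c * Int.fract (-1 / α)) (h2 : c * Int.fract (-1 / α) < (M : ℚ) + 1)
    (hc : M < c) : ⌈(c : ℚ) / α⌉₊ = c * b - M := by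
  have hcb : c ≤ c * b := Nat.le_mul_of_pos_right c P.b_pos
  have hα := P.pos
  have hdiv : (c : ℚ) / α = c * b - c * Int.fract (-1 / α) := by
    rw [div_eq_iff hα.ne', ← mul_sub, mul_assoc, mul_comm _ α, P.mul_sub, mul_one]
  rw [Nat.ceil_eq_iff (by omega), hdiv, Nat.cast_sub (by omega), Nat.cast_sub (by omega)]
  push_cast
  constructor <;> linarith

variable (h : IsBestLowerSeq α r q) (P : Params α (Int.fract (-1 / α)) b n)
include P

lemma ord2_pair (hι : ord2.Occurs α r) : ord2.pair α q = (2 * b, 2) := by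
  have := ceil_div_eq P (c := 2) (M := 0) (by simp)
    (by push_cast; linarith [hι.2]) two_pos
  exact Prod.ext (by simpa [pair] using this) rfl

lemma ord3_pair_of_lt (hθ : Int.fract (-1 / α) < 1 / 3) : ord3.pair α q = (3 * b, 3) := by
  have := ceil_div_eq P (c := 3) (M := 0) (by simp)
    (by push_cast; linarith) three_pos
  exact Prod.ext (by simpa [pair] using this) rfl

lemma ord3_pair_of_le (hθ : 1 / 2 ≤ Int.fract (-1 / α)) (hθ' : Int.fract (-1 / α) < 2 / 3) :
    ord3.pair α q = (3 * b - 1, 3) := by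
  have := ceil_div_eq P (c := 3) (M := 1) (by push_cast; linarith)
    (by push_cast; linarith) (by norm_num)
  exact Prod.ext (by simpa [pair] using this) rfl

include h

lemma sum12_pair (hι : sum12.Occurs α r) : sum12.pair α q = ((n + 1) * b - 1, n + 1) := by
  obtain ⟨-, hd, hc⟩ := h.two_eq P hι.1 hι.2
  obtain ⟨hd1, hc1⟩ := h.pair_one P
  have hn := P.three_le hι.1 hι.2
  have hnb : n ≤ n * b := Nat.le_mul_of_pos_right n P.b_pos
  refine Prod.ext ?_ ?_
  · change (q 1).den + (q 2).den = _
    rw [hd, hd1, add_mul]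
    omega
  · change (q 1).num.toNat + (q 2).num.toNat = _
    rw [hc, hc1, add_comm]

lemma isGenPair_pair {ι : GenIndex} (hι : ι.Occurs α r) :
    IsGenPair α (Int.fract (-1 / α)) b n (ι.pair α q).1 (ι.pair α q).2 := by
  cases ι with
  | best i =>
    refine .best (h.bestPair hι.1) fun h1 => hι.2 ((h.num_eq_one_iff P hι.1).1 ?_)
    change (q i).num.toNat = 1 at h1
    omega
  | ord2 =>
    rw [ord2_pair P hι]
    exact .ord2 hι.2
  | ord3 =>
    rcases hι with hι | hι
    · rw [ord3_pair_of_lt P hι.2]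
      exact .ord3_low hι.2
    · rw [ord3_pair_of_le P hι.1 hι.2]
      exact .ord3_high hι.1 hι.2
  | sum12 =>
    rw [sum12_pair h P hι]
    exact .sum12 hι.1 hι.2

lemma exists_pair_eq {d c : ℕ} (hp : IsGenPair α (Int.fract (-1 / α)) b n d c) :
    ∃ ι : GenIndex, ι.Occurs α r ∧ ι.pair α q = (d, c) := by
  cases hp with
  | best hp hc =>
    obtain ⟨i, hi, hd, hc'⟩ := h.exists_pair_eq hp
    refine ⟨best i, ⟨hi, fun h1 => hc ?_⟩, Prod.ext hd hc'⟩
    rw [← hc', (h.num_eq_one_iff P hi).2 h1, Int.toNat_one]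
  | ord2 hθ =>
    have hι : ord2.Occurs α r := ⟨P.nonneg, hθ⟩
    exact ⟨_, hι, ord2_pair P hι⟩
  | ord3_low hθ => exact ⟨ord3, Or.inl ⟨P.nonneg, hθ⟩, ord3_pair_of_lt P hθ⟩
  | ord3_high hθ hθ' => exact ⟨ord3, Or.inr ⟨hθ, hθ'⟩, ord3_pair_of_le P hθ hθ'⟩
  | sum12 h0 hθ =>
    have hι : sum12.Occurs α r := ⟨h0, hθ⟩
    exact ⟨_, hι, sum12_pair h P hι⟩

/-- The three exceptional pairs are not best lower approximations. -/
lemma not_bestPair {ι : GenIndex} (hι : ι.Occurs α r) (hne : ∀ i, ι ≠ best i) :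
    ¬ BestPair α (ι.pair α q).1 (ι.pair α q).2 := by
  have hb := P.b_pos
  cases ι with
  | best i => exact absurd rfl (hne i)
  | ord2 =>
    rw [ord2_pair P hι]
    exact fun hp => absurd (hp.coprime.eq_one_of_dvd (dvd_mul_right 2 b)) (by norm_num)
  | ord3 =>
    rcases hι with hι | hι
    · rw [ord3_pair_of_lt P hι.2]
      exact fun hp => absurd (hp.coprime.eq_one_of_dvd (dvd_mul_right 3 b)) (by norm_num)
    · rw [ord3_pair_of_le P hι.1 hι.2]
      intro hp
      have hp2 := P.best_two hι.1
      have := hp.max _ _ hp2.pos (by dsimp only; omega) hp2.le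
      dsimp only at this
      omega
  | sum12 =>
    rw [sum12_pair h P hι]
    intro hp
    have hpn := P.best_n hι.1 hι.2
    have hn := P.three_le hι.1 hι.2
    have hnb : n ≤ n * b := Nat.le_mul_of_pos_right n hb
    have := hp.max _ _ hpn.pos (by dsimp only; rw [add_mul]; omega) hpn.le
    have e1 : ((n + 1) * b - 1 : ℕ) = n * b + b - 1 := by rw [add_mul, one_mul]
    obtain ⟨b', rfl⟩ : ∃ b', b = b' + 1 := ⟨b - 1, by omega⟩
    obtain ⟨m, hm⟩ : ∃ m, n * (b' + 1) = m + 1 := ⟨n * (b' + 1) - 1, by omega⟩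
    dsimp only at this
    rw [e1, hm] at this
    have e2 : n * (m + 1 + (b' + 1) - 1) = n * m + n * (b' + 1) := by
      rw [show m + 1 + (b' + 1) - 1 = m + (b' + 1) by omega, mul_add]
    rw [e2, hm, Nat.add_sub_cancel, add_mul] at this
    omega

/-- The pairs in the list are pairwise distinct. -/
lemma pair_injective {ι κ : GenIndex} (hι : ι.Occurs α r) (hκ : κ.Occurs α r)
    (heq : ι.pair α q = κ.pair α q) : ι = κ := by
  have hbest : ∀ {ι : GenIndex} {i : ℕ}, ι.Occurs α r → (best i).Occurs α r →
      ι.pair α q = (best i).pair α q → ι = best i := by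
    intro ι i hι hi heq
    by_cases hne : ∃ j, ι = best j
    · obtain ⟨j, rfl⟩ := hne
      have h1 := congrArg Prod.fst heq
      have h2 := congrArg Prod.snd heq
      dsimp only [pair] at h1 h2
      rw [h.injOn hι.1 hi.1]
      rw [← num_toNat_div_den (h.mem hι.1).1, ← num_toNat_div_den (h.mem hi.1).1, h1, h2]
    · push Not at hne
      exact absurd (heq ▸ h.bestPair hi.1) (not_bestPair h P hι hne)
  have hsnd := congrArg Prod.snd heq
  cases κ with
  | best i => exact hbest hι hκ heq
  | ord2 | ord3 | sum12 =>
    cases ι with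
    | best i => exact (hbest hκ hι heq.symm).symm
    | ord2 | ord3 | sum12 =>
      first
      | rfl
      | simp only [pair] at hsnd; omega
      | have hn := P.three_le hι.1 hι.2
        rw [sum12_pair h P hι] at hsnd
        simp only [pair] at hsnd
        omega
      | have hn := P.three_le hκ.1 hκ.2
        rw [sum12_pair h P hκ] at hsnd
        simp only [pair] at hsnd
        omega

end GenIndex

/-! ### Generators of the section ring -/

section SectionRing

variable {k : Type*} [Field k] {W : WeierstrassCurve.Affine k} {α : ℚ}

lemma monomial_mem_sectionRing {D : Place k W.FunctionField →₀ ℚ} {d : ℕ} {f : W.FunctionField} :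
    Polynomial.monomial d f ∈ sectionRing k D ↔ f ∈ sections k ((d : ℚ) • D) := by
  constructor
  · intro h
    simpa using h d
  · intro h e
    rw [Polynomial.coeff_monomial]
    split_ifs with he
    · exact he ▸ h
    · exact zero_mem _

variable [W.IsElliptic] {t : ℕ → W.FunctionField}
  (ht : ∀ c : ℕ, c ≠ 1 → HasPolarDivisor k (infinity W) c (t c))
include ht

lemma mem_sections_of_admissible {d c : ℕ} (h : Admissible α d c) :
    t c ∈ sections k ((d : ℚ) • Finsupp.single (infinity W) α) :=
  (mem_sections_iff W).2 (Or.inr ⟨c, ht c h.1, h.2⟩)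

lemma mem_span_of_mem_sections {d : ℕ} {f : W.FunctionField}
    (hf : f ∈ sections k ((d : ℚ) • Finsupp.single (infinity W) α)) :
    f ∈ Submodule.span k (t '' {e | Admissible α d e}) := by
  rcases (mem_sections_iff W).1 hf with rfl | ⟨c, hc, hle⟩
  · exact zero_mem _
  · have hsub : {e | e ≠ 1 ∧ e ≤ c} ⊆ {e | Admissible α d e} := fun e he =>
      ⟨he.1, le_trans (by exact_mod_cast he.2) hle⟩
    exact Submodule.span_mono (Set.image_mono hsub) (mem_span_of_hasPolarDivisor W ht hc)

/-- A subalgebra of `K[u]` that contains `t_c u^d` for every pair in the list contains the whole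
section ring: by induction on the degree and on the pole order, a function with polar divisor
`c(∞)` differs from a multiple of `t_c` or of a product `t_{c₁} t_{c₂}` by one with a smaller pole
order. -/
lemma sectionRing_le {θ : ℚ} {b n : ℕ} (P : Params α θ b n) {A : Subalgebra k W.FunctionField[X]}
    (hA : ∀ d c, IsGenPair α θ b n d c → Polynomial.monomial d (t c) ∈ A) :
    sectionRing k (Finsupp.single (infinity W) α) ≤ A := by
  have key : ∀ (d c : ℕ) (f : W.FunctionField), HasPolarDivisor k (infinity W) c f →
      (c : ℚ) ≤ d * α → Polynomial.monomial d f ∈ A := by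
    intro d
    induction d using Nat.strong_induction_on with
    | _ d ihd =>
      intro c
      induction c using Nat.strong_induction_on with
      | _ c ihc =>
        intro f hf hle
        rcases Nat.eq_zero_or_pos d with rfl | hd
        · obtain rfl : c = 0 := by
            rw [Nat.cast_zero, zero_mul] at hle
            exact_mod_cast le_antisymm hle (by positivity)
          obtain ⟨a, rfl⟩ := exists_eq_smul_one W hf
          have : Polynomial.monomial 0 (a • (1 : W.FunctionField)) =
              algebraMap k W.FunctionField[X] a := by
            rw [Polynomial.monomial_zero_left, Polynomial.algebraMap_apply,
              Algebra.algebraMap_eq_smul_one]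
          rw [this]
          exact A.algebraMap_mem a
        obtain ⟨g, hg, hgA⟩ : ∃ g, HasPolarDivisor k (infinity W) c g ∧
            Polynomial.monomial d g ∈ A := by
          rcases P.isGenPair_or_splits hd ⟨hf.ne_one, hle⟩ with h | h
          · exact ⟨_, ht c hf.ne_one, hA d c h⟩
          · obtain ⟨d₁, c₁, d₂, c₂, h1, h2, hc1, hc2, rfl, rfl⟩ := h
            refine ⟨t c₁ * t c₂, (ht c₁ hc1.1).mul (ht c₂ hc2.1), ?_⟩
            rw [← Polynomial.monomial_mul_monomial]
            exact mul_mem (ihd d₁ (by omega) c₁ _ (ht c₁ hc1.1) hc1.2)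
              (ihd d₂ (by omega) c₂ _ (ht c₂ hc2.1) hc2.2)
        obtain ⟨a, h⟩ := exists_eq_zero_or_lt W hf hg
        rw [← sub_add_cancel f (a • g), map_add, ← Polynomial.smul_monomial]
        refine add_mem ?_ (A.smul_mem hgA a)
        rcases h with h | ⟨e, he, h⟩
        · rw [h, map_zero]
          exact zero_mem _
        · exact ihc e he _ h (le_trans (by exact_mod_cast he.le) hle)
  intro F hF
  rw [F.as_sum_support]
  refine sum_mem fun d _ => ?_
  rcases (mem_sections_iff W).1 (hF d) with h | ⟨c, hc, hle⟩
  · rw [h, map_zero]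
    exact zero_mem _
  · exact key d c _ hc hle

/-- If `V` is a space of functions containing all products of functions of degrees `i, j > 0` with
`i + j = d`, the elements of the section ring whose coefficient of `u^d` lies in `V` form a
subalgebra. -/
def coeffSubalgebra (V : Submodule k W.FunctionField) {d : ℕ} (hd : 0 < d)
    (hV : ∀ i j : ℕ, 0 < i → 0 < j → i + j = d → ∀ e f : ℕ, Admissible α i e → Admissible α j f →
      t e * t f ∈ V) : Subalgebra k W.FunctionField[X] where
  carrier := {F | F ∈ sectionRing k (Finsupp.single (infinity W) α) ∧ F.coeff d ∈ V}
  add_mem' hF hG := ⟨add_mem hF.1 hG.1, by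
    rw [Polynomial.coeff_add]
    exact add_mem hF.2 hG.2⟩
  mul_mem' := by
    rintro F G ⟨hF, hFV⟩ ⟨hG, hGV⟩
    have hconst : ∀ {F : W.FunctionField[X]},
        F ∈ sectionRing k (Finsupp.single (infinity W) α) →
        ∃ a : k, F.coeff 0 = a • (1 : W.FunctionField) := by
      intro F hF
      rcases (mem_sections_iff W).1 (hF 0) with h | ⟨c, hc, hle⟩
      · exact ⟨0, by rw [h, zero_smul]⟩
      · obtain rfl : c = 0 := by
          rw [Nat.cast_zero, zero_mul] at hle
          exact_mod_cast le_antisymm hle (by positivity)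
        exact exists_eq_smul_one W hc
    refine ⟨mul_mem hF hG, ?_⟩
    rw [Polynomial.coeff_mul]
    refine sum_mem ?_
    rintro ⟨i, j⟩ hij
    rw [Finset.HasAntidiagonal.mem_antidiagonal] at hij
    dsimp only at hij ⊢
    rcases Nat.eq_zero_or_pos i with rfl | hi
    · obtain ⟨a, ha⟩ := hconst hF
      rw [zero_add] at hij
      rw [ha, hij, smul_mul_assoc, one_mul]
      exact V.smul_mem a hGV
    rcases Nat.eq_zero_or_pos j with rfl | hj
    · obtain ⟨a, ha⟩ := hconst hG
      rw [add_zero] at hij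
      rw [ha, hij, mul_smul_comm, mul_one]
      exact V.smul_mem a hFV
    have h := Submodule.mul_mem_mul (mem_span_of_mem_sections ht (hF i))
      (mem_span_of_mem_sections ht (hG j))
    rw [Submodule.span_mul_span] at h
    refine Submodule.span_le.2 ?_ h
    rintro _ ⟨_, ⟨e, he, rfl⟩, _, ⟨f, hf, rfl⟩, rfl⟩
    exact hV i j hi hj hij e f he hf
  algebraMap_mem' a := ⟨Subalgebra.algebraMap_mem _ a, by
    rw [Polynomial.algebraMap_apply, Polynomial.coeff_C, if_neg hd.ne']
    exact zero_mem _⟩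

/-- No pair in the list can be omitted. The coefficient of `u^d` of an element generated by the
other `t_{c'} u^{d'}` lies in the span of functions `t'_e`, `e ≠ c`, with polar divisors `e(∞)`.
Here `t' = t` except for the pair `(2, 3)`, where `t'_4 = t_2²` accounts for the only product whose
pole order exceeds `c`. -/
lemma mem_of_adjoin_eq {θ : ℚ} {b n : ℕ} (P : Params α θ b n) {s : Set (ℕ × ℕ)}
    (hs : ∀ p ∈ s, IsGenPair α θ b n p.1 p.2)
    (hadj : sectionRing k (Finsupp.single (infinity W) α) ≤
      Algebra.adjoin k ((fun p : ℕ × ℕ => Polynomial.monomial p.1 (t p.2)) '' s))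
    {d c : ℕ} (hdc : IsGenPair α θ b n d c) : (d, c) ∈ s := by
  classical
  by_contra hnot
  have hd := P.isGenPair_pos hdc
  have hadm := P.isGenPair_admissible hdc
  set exc : Prop := d = 2 ∧ c = 3 ∧ Admissible α 1 2 with hexc
  set t' : ℕ → W.FunctionField := fun e => if exc ∧ e = 4 then t 2 * t 2 else t e with ht'def
  have ht' : ∀ e : ℕ, e ≠ 1 → HasPolarDivisor k (infinity W) e (t' e) := by
    intro e he
    by_cases h : exc ∧ e = 4
    · simp only [ht'def, if_pos h]
      rw [h.2]
      exact (ht 2 (by norm_num)).mul (ht 2 (by norm_num))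
    · simp only [ht'def, if_neg h]
      exact ht e he
  set V := Submodule.span k (t' '' {e | e ≠ 1 ∧ e ≠ c}) with hVdef
  have hV : ∀ i j : ℕ, 0 < i → 0 < j → i + j = d → ∀ e f : ℕ, Admissible α i e →
      Admissible α j f → t e * t f ∈ V := by
    intro i j hi hj hij e f he hf
    rcases P.lt_of_isGenPair hdc hi hj hij he hf with h | ⟨rfl, rfl, rfl, rfl⟩
    · have hsub : {i | i ≠ 1 ∧ i ≤ e + f} ⊆ {i | i ≠ 1 ∧ i ≠ c} := fun i hi =>
        ⟨hi.1, (lt_of_le_of_lt hi.2 h).ne⟩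
      exact Submodule.span_mono (Set.image_mono hsub)
        (mem_span_of_hasPolarDivisor W ht' ((ht e he.1).mul (ht f hf.1)))
    · obtain rfl : i = 1 := by omega
      refine Submodule.subset_span ⟨4, ⟨by norm_num, by norm_num⟩, ?_⟩
      exact if_pos ⟨⟨rfl, rfl, he⟩, rfl⟩
  have hle : Algebra.adjoin k ((fun p : ℕ × ℕ => Polynomial.monomial p.1 (t p.2)) '' s) ≤
      coeffSubalgebra ht V hd hV := by
    refine Algebra.adjoin_le ?_
    rintro _ ⟨⟨d', c'⟩, hp, rfl⟩
    have hgen := hs _ hp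
    have hadm' := P.isGenPair_admissible hgen
    refine ⟨monomial_mem_sectionRing.2 (mem_sections_of_admissible ht hadm'), ?_⟩
    rw [Polynomial.coeff_monomial]
    split_ifs with hdd
    · dsimp only at hdd hgen hadm' ⊢
      subst hdd
      have hcc : c' ≠ c := by
        rintro rfl
        exact hnot hp
      refine Submodule.subset_span ⟨c', ⟨hadm'.1, hcc⟩, if_neg ?_⟩
      -- the pair `(2, 4) = (1, 2) + (1, 2)` is not in the list
      rintro ⟨⟨rfl, rfl, h12⟩, rfl⟩
      have := P.lt_of_isGenPair hgen one_pos one_pos rfl h12 h12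
      omega
    · exact zero_mem _
  have hmem := (hle (hadj (monomial_mem_sectionRing.2 (mem_sections_of_admissible ht hadm)))).2
  rw [Polynomial.coeff_monomial, if_pos rfl] at hmem
  have htc : t c = t' c := by
    refine (if_neg ?_).symm
    rintro ⟨⟨-, h3, -⟩, h4⟩
    omega
  rw [htc] at hmem
  exact notMem_span_of_hasPolarDivisor ht' hadm.1 hmem

end SectionRing

end

end EllipticSection

theorem mainTheorem1 {k : Type*} [Field k] (W : WeierstrassCurve k) [W.IsElliptic]
    (α : ℚ) (hα : 0 < α) :
    -- the nonnegative best lower approximations `0 = q 0 < q 1 < ⋯ < q r = α`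
    ∃ (r : ℕ) (q : ℕ → ℚ), EllipticSection.IsBestLowerSeq α r q ∧ q 0 = 0 ∧ q r = α ∧
      (∀ i ≤ r, (q i).num = 1 ↔ i = 1) ∧
      (EllipticSection.GenIndex.sum12.Occurs α r → 2 ≤ r) ∧
      -- functions `t_c` with polar divisor `c(∞)` exist for all `c ≠ 1`
      (∃ t : ℕ → W.toAffine.FunctionField, ∀ c : ℕ, c ≠ 1 →
        EllipticSection.HasPolarDivisor k (EllipticSection.infinity W.toAffine) c (t c)) ∧
      -- and for any choice of them, the functions `t_c u^d` minimally generate the section ring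
      ∀ t : ℕ → W.toAffine.FunctionField,
        (∀ c : ℕ, c ≠ 1 →
          EllipticSection.HasPolarDivisor k (EllipticSection.infinity W.toAffine) c (t c)) →
        EllipticSection.IsMinimalGenerating
          (EllipticSection.sectionRing k
            (Finsupp.single (EllipticSection.infinity W.toAffine) α))
          (fun ι : {ι : EllipticSection.GenIndex // ι.Occurs α r} =>
            Polynomial.monomial (ι.1.pair α q).1 (t (ι.1.pair α q).2)) := by
  obtain ⟨b, n, P⟩ := EllipticSection.exists_params hα
  obtain ⟨r, q, h⟩ := EllipticSection.exists_isBestLowerSeq hα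
  have : W.toAffine.IsElliptic := inferInstanceAs W.IsElliptic
  refine ⟨r, q, h, h.zero_eq P, h.last_eq hα, fun i hi => h.num_eq_one_iff P hi,
    fun hθ => (h.two_eq P hθ.1 hθ.2).1, ?_, fun t ht => ⟨?_, fun J hJ => ?_⟩⟩
  · choose f hf using fun (c : ℕ) (hc : c ≠ 1) =>
      EllipticSection.exists_hasPolarDivisor_of_ne_one W.toAffine hc
    exact ⟨fun c => if hc : c ≠ 1 then f c hc else 0, fun c hc => by simpa [hc] using hf c hc⟩
  · refine le_antisymm (Algebra.adjoin_le ?_) (EllipticSection.sectionRing_le ht P fun d c hdc => ?_)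
    · rintro _ ⟨⟨ι, hι⟩, rfl⟩
      exact EllipticSection.monomial_mem_sectionRing.2 (EllipticSection.mem_sections_of_admissible
        ht (P.isGenPair_admissible (EllipticSection.GenIndex.isGenPair_pair h P hι)))
    · obtain ⟨ι, hι, hpair⟩ := EllipticSection.GenIndex.exists_pair_eq h P hdc
      refine Algebra.subset_adjoin ⟨⟨ι, hι⟩, ?_⟩
      dsimp only
      rw [hpair]
  · refine Set.eq_univ_of_forall fun ι => ?_
    have hmem := EllipticSection.mem_of_adjoin_eq ht P
      (s := (fun ι : {ι : EllipticSection.GenIndex // ι.Occurs α r} => ι.1.pair α q) '' J)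
      (by
        rintro _ ⟨κ, -, rfl⟩
        exact EllipticSection.GenIndex.isGenPair_pair h P κ.2)
      (by
        rw [Set.image_image]
        exact hJ.ge)
      (EllipticSection.GenIndex.isGenPair_pair h P ι.2)
    obtain ⟨κ, hκ, heq⟩ := hmem
    have := EllipticSection.GenIndex.pair_injective h P κ.2 ι.2 heq
    exact Subtype.ext this ▸ hκ
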